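/- Let $K$ be a number field and let $E$ be an elliptic curve over $K$ with $E(K)[2]\simeq \mathbb{Z}/2\mathbb{Z}$. Let $C=E(K)[2]$, let $\phi:E\to E'$ be an isogeny of elliptic curves defined over $K$ with kernel $C$ (so $E'=E/C$), and let $\hat\phi:E'\to E$ be its dual isogeny, so that $\hat\phi\circ\phi=[2]_E$ and $\phi\circ\hat\phi=[2]_{E'}$. For a homomorphism $f:A\to B$ among $\phi$, $\hat\phi$, $[2]_E$, let $$\mathrm{Sel}_f(A/K)=\ker\Big(H^1(K,A[f])\to\bigoplus_{v} H^1(K_v,A[f])/H^1_f(K_v,A[f])\Big),$$ where $A[f]$ is the Galois module of geometric points of $A$ killed by $f$, where $v$ runs over all places of $K$, finite and infinite, and where $H^1_f(K_v,A[f])$ is the image of the connecting map $B(K_v)/f(A(K_v))\to H^1(K_v,A[f])$ sending $Q$ to the class of the cocycle $\sigma\mapsto\sigma(R)-R$, with $R\in A(\overline{K_v})$ and $f(R)=Q$. Write $\mathrm{Sel}_2(E/K)=\mathrm{Sel}_{[2]}(E/K)$ and $$d_2(E/K)=\dim_{\mathbb{F}_2}\mathrm{Sel}_2(E/K)-\dim_{\mathbb{F}_2}E(K)[2],\qquad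 \mathcal{T}(E/E')=\frac{|\mathrm{Sel}_\phi(E/K)|}{|\mathrm{Sel}_{\hat\phi}(E'/K)|}.$$ Suppose that $K(E[2])=K(E'[2])$, where $K(A[2])\subseteq\overline{K}$ denotes the field generated over $K$ by the coordinates of the points of $A[2]$. Then the groups $\mathrm{Sel}_2(E/K)$, $\mathrm{Sel}_\phi(E/K)$ and $\mathrm{Sel}_{\hat\phi}(E'/K)$ are finite, and $$d_2(E/K)\ \ge\ \mathrm{ord}_2\,\mathcal{T}(E/E').$$ -/

import Mathlib

open scoped Classical Polynomial.Bivariate NumberField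

universe u

noncomputable section

namespace TwoDescent

/-! ### First continuous cohomology of a discrete module -/

section Cohomology

variable (G : Type*) [Group G] [TopologicalSpace G]
variable (A : Type*) [AddCommGroup A] [DistribMulAction G A]

/-- Continuous 1-cocycles `c : G → A`, for the discrete topology on `A`:
`c (σ τ) = c σ + σ (c τ)`. -/
def Z1 : AddSubgroup (G → A) where
  carrier := {c | IsLocallyConstant c ∧ ∀ σ τ : G, c (σ * τ) = c σ + σ • c τ}
  zero_mem' := ⟨IsLocallyConstant.const 0, by simp⟩
  add_mem' := by
    rintro a b ⟨ha, ha'⟩ ⟨hb, hb'⟩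
    refine ⟨ha.add hb, fun σ τ => ?_⟩
    simp only [Pi.add_apply, ha', hb', smul_add]
    abel
  neg_mem' := by
    rintro a ⟨ha, ha'⟩
    refine ⟨ha.neg, fun σ τ => ?_⟩
    simp only [Pi.neg_apply, ha', smul_neg]
    abel

/-- The 1-coboundary `σ ↦ σ a - a`, as a homomorphism in `a`. -/
def coboundary : A →+ (G → A) where
  toFun a σ := σ • a - a
  map_zero' := by ext; simp
  map_add' a b := by ext σ; simp only [smul_add, Pi.add_apply]; abel

/-- 1-coboundaries, as a subgroup of the continuous 1-cocycles. -/
def B1 : AddSubgroup (Z1 G A) := (coboundary G A).range.addSubgroupOf (Z1 G A)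

/-- `H¹(G, A)`: continuous 1-cocycles modulo 1-coboundaries. -/
abbrev H1 : Type _ := Z1 G A ⧸ B1 G A

variable {G A}

/-- The map on 1-cocycles induced by a compatible pair `r : H → G`, `f : A → B`. -/
def Z1.map {H : Type*} [Group H] [TopologicalSpace H] {B : Type*} [AddCommGroup B]
    [DistribMulAction H B] (r : H →* G) (hr : Continuous r) (f : A →+ B)
    (hf : ∀ (σ : H) (a : A), f (r σ • a) = σ • f a) : Z1 G A →+ Z1 H B where
  toFun c := ⟨fun σ => f (c.1 (r σ)), (c.2.1.comp_continuous hr).comp f, fun σ τ => by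
    change f (c.1 (r (σ * τ))) = f (c.1 (r σ)) + σ • f (c.1 (r τ))
    rw [map_mul, c.2.2, map_add, hf]⟩
  map_zero' := by ext; simp
  map_add' a b := by ext; simp

/-- The map `H¹(G, A) → H¹(H, B)` induced by a compatible pair `r : H → G`, `f : A → B`. -/
def H1.map {H : Type*} [Group H] [TopologicalSpace H] {B : Type*} [AddCommGroup B]
    [DistribMulAction H B] (r : H →* G) (hr : Continuous r) (f : A →+ B)
    (hf : ∀ (σ : H) (a : A), f (r σ • a) = σ • f a) : H1 G A →+ H1 H B :=
  QuotientAddGroup.map _ _ (Z1.map r hr f hf) (by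
    rintro c ⟨a, ha⟩
    refine ⟨f a, funext fun σ => ?_⟩
    have := congrFun ha (r σ)
    simp only [coboundary, AddMonoidHom.coe_mk, ZeroHom.coe_mk, AddSubgroup.coe_subtype] at this
    simp [coboundary, Z1.map, ← this, hf])

end Cohomology

/-! ### Homomorphisms and isogenies of elliptic curves -/

variable {K : Type u} [Field K]

/-- The group `E(L)` of points of `E` over an extension field `L` of `K`. -/
abbrev Pts (E : WeierstrassCurve K) (L : Type u) [Field L] [Algebra K L] : Type u :=
  (E.baseChange L).toAffine.Point

/-- A homomorphism of the group functors `L ↦ E(L)`, `L ↦ E'(L)` on field extensions of `K`. -/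
structure PtsHom (E E' : WeierstrassCurve K) where
  /-- The homomorphism on `L`-points. -/
  on (L : Type u) [Field L] [Algebra K L] : Pts E L →+ Pts E' L
  /-- Compatibility with embeddings of fields over `K`. -/
  natural (L M : Type u) [Field L] [Algebra K L] [Field M] [Algebra K M] (f : L →ₐ[K] M)
    (P : Pts E L) :
    on M (WeierstrassCurve.Affine.Point.map f P) = WeierstrassCurve.Affine.Point.map f (on L P)

/-- An isogeny `E → E'` over `K`: a homomorphism on points that is given by a nonconstant rational
map with coefficients in `K`. Here `q` is a common denominator which does not vanish identically on
`E`, and `(x, y) ↦ (pX (x, y) / q (x, y), pY (x, y) / q (x, y))` wherever `q (x, y) ≠ 0`. (The map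
is nonconstant because it is a homomorphism that does not send the generic point to `O`.) -/
structure Isogeny (E E' : WeierstrassCurve K) extends PtsHom E E' where
  rational : ∃ pX pY q : K[X][Y],
    WeierstrassCurve.Affine.CoordinateRing.mk E.toAffine q ≠ 0 ∧
    ∀ (L : Type u) [Field L] [Algebra K L] (x y : L)
      (h : (E.baseChange L).toAffine.Nonsingular x y),
      q.aevalAeval x y ≠ 0 →
      ∃ h' : (E'.baseChange L).toAffine.Nonsingular
          (pX.aevalAeval x y / q.aevalAeval x y) (pY.aevalAeval x y / q.aevalAeval x y),
        on L (.some x y h) = .some _ _ h'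

/-- Multiplication by `2` on `E`. -/
def mulTwo (E : WeierstrassCurve K) : PtsHom E E where
  on _ _ _ := 2 • AddMonoidHom.id _
  natural L M _ _ _ _ f P := by simp

/-- `ψ : E' → E` is dual to the degree-two isogeny `φ : E → E'`: the composites `ψ ∘ φ` and `φ ∘ ψ`
are multiplication by `2` on `E` and on `E'`. -/
def IsDualTwoIsogeny {E E' : WeierstrassCurve K} (φ : Isogeny E E') (ψ : Isogeny E' E) : Prop :=
  ∀ (L : Type u) [Field L] [Algebra K L],
    (∀ P : Pts E L, ψ.on L (φ.on L P) = 2 • P) ∧ (∀ Q : Pts E' L, φ.on L (ψ.on L Q) = 2 • Q)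

/-! ### Galois action on points -/

section Galois

variable (F : Type u) [Field F] [Algebra K F]

/-- The absolute Galois group of `F`, with the Krull topology. -/
abbrev GalAbs (F : Type u) [Field F] : Type u := AlgebraicClosure F ≃ₐ[F] AlgebraicClosure F

/-- The absolute Galois group of `F ⊇ K` acts on the points of `E` over the algebraic closure of
`F` by acting on coordinates. -/
instance galPts (E : WeierstrassCurve K) :
    DistribMulAction (GalAbs F) (Pts E (AlgebraicClosure F)) where
  smul σ P := WeierstrassCurve.Affine.Point.map (W' := E.toAffine)
    (σ : AlgebraicClosure F →ₐ[F] AlgebraicClosure F) P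
  one_smul P := by cases P <;> rfl
  mul_smul σ τ P := by cases P <;> rfl
  smul_zero σ := rfl
  smul_add σ P Q := map_add _ P Q

variable {E E' : WeierstrassCurve K}

theorem PtsHom.on_smul (f : PtsHom E E') (σ : GalAbs F) (P : Pts E (AlgebraicClosure F)) :
    f.on (AlgebraicClosure F) (σ • P) = σ • f.on (AlgebraicClosure F) P := by
  have h := f.natural (AlgebraicClosure F) (AlgebraicClosure F)
    ((σ : AlgebraicClosure F →ₐ[F] AlgebraicClosure F).restrictScalars K) P
  have e : ∀ (W : WeierstrassCurve K) (Q : Pts W (AlgebraicClosure F)),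
      WeierstrassCurve.Affine.Point.map (W' := W.toAffine)
        ((σ : AlgebraicClosure F →ₐ[F] AlgebraicClosure F).restrictScalars K) Q = σ • Q := by
    intro W Q; cases Q <;> rfl
  rwa [e, e] at h

/-- The kernel of `f : E → E'`, as a Galois module: the subgroup of geometric points killed
by `f`. -/
abbrev PtsHom.kernel (f : PtsHom E E') : AddSubgroup (Pts E (AlgebraicClosure F)) :=
  (f.on (AlgebraicClosure F)).ker

instance galKernel (f : PtsHom E E') : DistribMulAction (GalAbs F) (f.kernel F) where
  smul σ P := ⟨σ • P.1, by
    have hP := P.2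
    rw [AddMonoidHom.mem_ker] at hP ⊢
    rw [f.on_smul F, hP, smul_zero]⟩
  one_smul P := Subtype.ext (one_smul _ P.1)
  mul_smul σ τ P := Subtype.ext (mul_smul σ τ P.1)
  smul_zero σ := Subtype.ext (smul_zero σ)
  smul_add σ P Q := Subtype.ext (smul_add σ P.1 Q.1)

/-- `H¹(F, ker f)`. -/
abbrev H1Ker (f : PtsHom E E') : Type u := H1 (GalAbs F) (f.kernel F)

/-- The image of the connecting map `E'(F)/f(E(F)) → H¹(F, ker f)`, which sends `Q` to the class of
`σ ↦ σ(R) - R` for any geometric point `R` of `E` with `f(R) = Q`. -/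
def kummerImage (f : PtsHom E E') : AddSubgroup (H1Ker F f) where
  carrier := {ξ | ∃ (Q : Pts E' F) (R : Pts E (AlgebraicClosure F))
      (c : Z1 (GalAbs F) (f.kernel F)),
    f.on (AlgebraicClosure F) R =
      WeierstrassCurve.Affine.Point.baseChange F (AlgebraicClosure F) Q ∧
    (∀ σ : GalAbs F, ((c.1 σ : f.kernel F) : Pts E (AlgebraicClosure F)) = σ • R - R) ∧
    ξ = QuotientAddGroup.mk c}
  zero_mem' := ⟨0, 0, 0, by simp, by simp, rfl⟩
  add_mem' := by
    rintro _ _ ⟨Q, R, c, h, hc, rfl⟩ ⟨Q', R', c', h', hc', rfl⟩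
    refine ⟨Q + Q', R + R', c + c', by rw [map_add, map_add, h, h'], fun σ => ?_, rfl⟩
    simp only [AddSubgroup.coe_add, Pi.add_apply, hc, hc', smul_add]
    abel
  neg_mem' := by
    rintro _ ⟨Q, R, c, h, hc, rfl⟩
    refine ⟨-Q, -R, -c, by rw [map_neg, map_neg, h], fun σ => ?_, rfl⟩
    simp only [AddSubgroup.coe_neg, Pi.neg_apply, hc, smul_neg]
    abel

/-! ### Restriction from `K` to an extension field -/

/-- A chosen embedding over `K` of the algebraic closure of `K` in that of `F`. -/
def closureEmb : AlgebraicClosure K →ₐ[K] AlgebraicClosure F := IsAlgClosed.lift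

/-- Restriction of automorphisms along `closureEmb`. -/
def resGal : GalAbs F →* GalAbs K :=
  letI : Algebra (AlgebraicClosure K) (AlgebraicClosure F) := (closureEmb (K := K) F).toRingHom.toAlgebra
  haveI : IsScalarTower K (AlgebraicClosure K) (AlgebraicClosure F) :=
    IsScalarTower.of_algebraMap_eq fun x => ((closureEmb (K := K) F).commutes x).symm
  { toFun := fun σ => (σ.restrictScalars K).restrictNormal (AlgebraicClosure K)
    map_one' := by
      ext x
      apply (closureEmb (K := K) F).injective
      exact AlgEquiv.restrictNormal_commutes _ (AlgebraicClosure K) x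
    map_mul' := fun σ τ => by
      ext x
      apply (closureEmb (K := K) F).injective
      refine (AlgEquiv.restrictNormal_commutes _ (AlgebraicClosure K) x).trans ?_
      symm
      refine (AlgEquiv.restrictNormal_commutes (σ.restrictScalars K) (AlgebraicClosure K) _).trans ?_
      exact congrArg σ (AlgEquiv.restrictNormal_commutes (τ.restrictScalars K) (AlgebraicClosure K) x) }

theorem closureEmb_resGal (σ : GalAbs F) (x : AlgebraicClosure K) :
    closureEmb F (resGal (K := K) F σ x) = σ (closureEmb F x) := by
  let : Algebra (AlgebraicClosure K) (AlgebraicClosure F) := (closureEmb (K := K) F).toRingHom.toAlgebra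
  have : IsScalarTower K (AlgebraicClosure K) (AlgebraicClosure F) :=
    IsScalarTower.of_algebraMap_eq fun x => ((closureEmb (K := K) F).commutes x).symm
  exact AlgEquiv.restrictNormal_commutes (σ.restrictScalars K) (AlgebraicClosure K) x

theorem continuous_resGal : Continuous (resGal (K := K) F) := by
  refine continuous_of_continuousAt_one _ ?_
  rw [ContinuousAt, map_one]
  intro U hU
  obtain ⟨L, hL, hLU⟩ := (krullTopology_mem_nhds_one_iff K (AlgebraicClosure K) U).mp hU
  let b := Module.finBasis K L
  have hopen : ∀ i, IsOpen
      ((MulAction.stabilizer (GalAbs F) (closureEmb (K := K) F (b i : AlgebraicClosure K)) :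
        Subgroup (GalAbs F)) : Set (GalAbs F)) :=
    fun i => stabilizer_isOpen_of_isIntegral _
  have hmem : (⋂ i, ((MulAction.stabilizer (GalAbs F) (closureEmb (K := K) F (b i : AlgebraicClosure K)) :
      Subgroup (GalAbs F)) : Set (GalAbs F))) ∈ nhds (1 : GalAbs F) :=
    (isOpen_iInter_of_finite hopen).mem_nhds (Set.mem_iInter.mpr fun i => one_mem _)
  refine Filter.mem_map.mpr (Filter.mem_of_superset hmem fun σ hσ => hLU ?_)
  have hfix : ∀ i, resGal (K := K) F σ (b i : AlgebraicClosure K) = (b i : AlgebraicClosure K) := fun i => by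
    apply (closureEmb (K := K) F).injective
    exact (closureEmb_resGal F σ _).trans (Set.mem_iInter.mp hσ i)
  have hlin : (resGal (K := K) F σ).toLinearMap ∘ₗ L.val.toLinearMap = L.val.toLinearMap :=
    b.ext hfix
  exact (IntermediateField.mem_fixingSubgroup_iff _ _).mpr fun x hx =>
    LinearMap.congr_fun hlin ⟨x, hx⟩

/-- The map from `ker f` over the algebraic closure of `K` to that over the algebraic closure
of `F`. -/
def kernelEmb (f : PtsHom E E') : f.kernel K →+ f.kernel F :=
  ((WeierstrassCurve.Affine.Point.map (W' := E.toAffine) (closureEmb (K := K) F)).comp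
    (f.kernel K).subtype).codRestrict (f.kernel F) (fun P => by
      have hP := P.2
      rw [AddMonoidHom.mem_ker] at hP ⊢
      simp only [AddMonoidHom.coe_comp, AddSubgroup.coe_subtype, Function.comp_apply]
      rw [f.natural, hP, map_zero])

theorem kernelEmb_smul (f : PtsHom E E') (σ : GalAbs F) (P : f.kernel K) :
    kernelEmb F f (resGal (K := K) F σ • P) = σ • kernelEmb F f P := by
  apply Subtype.ext
  obtain ⟨P, hP⟩ := P
  have key : ∀ Q : Pts E (AlgebraicClosure K),
      WeierstrassCurve.Affine.Point.map (W' := E.toAffine) (closureEmb (K := K) F)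
        (resGal (K := K) F σ • Q) =
      σ • WeierstrassCurve.Affine.Point.map (W' := E.toAffine) (closureEmb (K := K) F) Q := by
    rintro (_ | ⟨x, y, h⟩)
    · rfl
    · exact (WeierstrassCurve.Affine.Point.some.injEq ..).mpr
        ⟨closureEmb_resGal F σ x, closureEmb_resGal F σ y⟩
  exact key P

/-- The restriction map `H¹(K, ker f) → H¹(F, ker f)`. -/
def res (f : PtsHom E E') : H1Ker K f →+ H1Ker F f :=
  H1.map (resGal (K := K) F) (continuous_resGal F) (kernelEmb F f) (kernelEmb_smul F f)

end Galois

/-! ### Selmer groups -/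

section Selmer

variable [NumberField K]

/-- The Selmer group of `f : E → E'`: the classes in `H¹(K, ker f)` whose restriction to the
completion `K_v` lies in the image of `E'(K_v)`, for every place `v`, finite or infinite. -/
def Selmer {E E' : WeierstrassCurve K} (f : PtsHom E E') : AddSubgroup (H1Ker K f) :=
  (⨅ v : IsDedekindDomain.HeightOneSpectrum (𝓞 K),
    (kummerImage (v.adicCompletion K) f).comap (res (v.adicCompletion K) f)) ⊓
  (⨅ v : NumberField.InfinitePlace K,
    (kummerImage v.Completion f).comap (res v.Completion f))

/-- The 2-Selmer group of `E`. -/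
abbrev Sel₂ (E : WeierstrassCurve K) : AddSubgroup (H1Ker K (mulTwo E)) := Selmer (mulTwo E)

/-- The Tamagawa ratio `|Sel_φ(E/K)| / |Sel_ψ(E'/K)|`. -/
def tamagawaRatio {E E' : WeierstrassCurve K} (φ : Isogeny E E') (ψ : Isogeny E' E) : ℚ :=
  (Nat.card (Selmer φ.toPtsHom) : ℚ) / (Nat.card (Selmer ψ.toPtsHom) : ℚ)

end Selmer

/-! ### The 2-Selmer rank and the 2-division field -/

/-- The dimension over `𝔽₂` of an abelian group killed by `2`. -/
def dimF₂ (A : Type*) [AddCommGroup A] (h : ∀ a : A, 2 • a = 0) : ℕ :=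
  letI : Module (ZMod 2) A := AddCommGroup.zmodModule h
  Module.finrank (ZMod 2) A

theorem two_nsmul_sel₂ [NumberField K] (E : WeierstrassCurve K) (ξ : Sel₂ E) : 2 • ξ = 0 := by
  obtain ⟨ξ, hξ⟩ := ξ
  apply Subtype.ext
  obtain ⟨c, rfl⟩ := QuotientAddGroup.mk_surjective ξ
  have hc : 2 • c = 0 := by
    apply Subtype.ext
    funext σ
    apply Subtype.ext
    exact (c.1 σ).2
  change 2 • (QuotientAddGroup.mk' (B1 _ _) c) = 0
  rw [← map_nsmul, hc, map_zero]

/-- `E(L)[2]`. -/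
abbrev twoTorsion (E : WeierstrassCurve K) (L : Type u) [Field L] [Algebra K L] :
    AddSubgroup (Pts E L) := AddSubgroup.torsionBy (Pts E L) 2

/-- The 2-Selmer rank `d₂(E/K) = dim Sel₂(E/K) - dim E(K)[2]`. -/
def d₂ [NumberField K] (E : WeierstrassCurve K) : ℤ :=
  (dimF₂ (Sel₂ E) (two_nsmul_sel₂ E) : ℤ) -
    (dimF₂ (twoTorsion E K) (AddSubgroup.torsionBy.nsmul (n := 2)) : ℤ)

/-- The field `K(E[2])`, generated over `K` by the coordinates of the geometric 2-torsion
points. -/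
def twoDivisionField (E : WeierstrassCurve K) :
    IntermediateField K (AlgebraicClosure K) :=
  IntermediateField.adjoin K {z | ∃ (x y : AlgebraicClosure K)
    (h : (E.baseChange (AlgebraicClosure K)).toAffine.Nonsingular x y),
    (.some x y h : Pts E (AlgebraicClosure K)) ∈ twoTorsion E (AlgebraicClosure K) ∧
      (z = x ∨ z = y)}

/-- `E(K)[2]`, viewed inside the geometric points of `E`. -/
def rationalTwoTorsion (E : WeierstrassCurve K) : AddSubgroup (Pts E (AlgebraicClosure K)) :=
  (twoTorsion E K).map (WeierstrassCurve.Affine.Point.baseChange K (AlgebraicClosure K))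

end TwoDescent

end

namespace TwoDescent

section SelmerGroup

open IsDedekindDomain nonZeroDivisors

variable {R : Type*} [CommRing R] [IsDedekindDomain R] {L : Type*} [Field L]
  [Algebra R L] [IsFractionRing R L]

theorem count_spanSingleton_eq (v : HeightOneSpectrum R) (x : Lˣ) :
    FractionalIdeal.count L v (FractionalIdeal.spanSingleton R⁰ (x : L)) =
      -Multiplicative.toAdd (v.valuationOfNeZero x) := by
  classical
  obtain ⟨n, d, hx⟩ := IsLocalization.exists_mk'_eq R⁰ (x : L)
  have hn : n ≠ 0 := by
    rintro rfl
    exact x.ne_zero (by rw [← hx, IsLocalization.mk'_zero])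
  have hd : (d : R) ≠ 0 := nonZeroDivisors.coe_ne_zero d
  have hval : (v.valuationOfNeZero x : WithZero (Multiplicative ℤ)) = v.valuation L (x : L) :=
    v.valuationOfNeZero_eq x
  rw [← hx, HeightOneSpectrum.valuation_of_mk', HeightOneSpectrum.intValuation_if_neg _ hn,
    HeightOneSpectrum.intValuation_if_neg _ hd, ← WithZero.exp_sub] at hval
  have h2 : v.valuationOfNeZero x = Multiplicative.ofAdd _ := WithZero.coe_inj.mp hval
  rw [h2, FractionalIdeal.count_well_defined L v (a := (d : R)) (J := Ideal.span {n})]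
  · simp only [toAdd_ofAdd]; ring
  · exact FractionalIdeal.spanSingleton_ne_zero_iff.mpr x.ne_zero
  · rw [FractionalIdeal.coeIdeal_span_singleton, FractionalIdeal.spanSingleton_mul_spanSingleton,
      ← hx, IsFractionRing.mk'_eq_div, div_eq_inv_mul]

theorem valuationOfNeZeroMod_mk_eq_one_iff (v : HeightOneSpectrum R) (n : ℕ) (x : Lˣ) :
    v.valuationOfNeZeroMod n (QuotientGroup.mk x) = 1 ↔
      (n : ℤ) ∣ Multiplicative.toAdd (v.valuationOfNeZero x) := by
  rw [← Int.mem_zmultiples_iff]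
  refine Iff.trans (MulEquiv.map_eq_one_iff
    (Int.quotientZMultiplesNatEquivZMod n).toMultiplicative) ?_
  exact QuotientGroup.eq_one_iff (N := AddSubgroup.toSubgroup (AddSubgroup.zmultiples (n : ℤ)))
    (v.valuationOfNeZero x)

theorem fractionalIdeal_eq_of_count_eq {I J : FractionalIdeal R⁰ L} (hI : I ≠ 0) (hJ : J ≠ 0)
    (h : ∀ v : HeightOneSpectrum R, FractionalIdeal.count L v I = FractionalIdeal.count L v J) :
    I = J := by
  rw [← FractionalIdeal.finprod_heightOneSpectrum_factorization' L hI,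
    ← FractionalIdeal.finprod_heightOneSpectrum_factorization' L hJ]
  simp only [h]

/-- If all valuations of `x` are divisible by `n`, the ideal `(x)` is an `n`-th power. -/
theorem exists_pow_eq_toPrincipalIdeal {n : ℕ} (x : Lˣ)
    (h : ∀ v : HeightOneSpectrum R, (n : ℤ) ∣ Multiplicative.toAdd (v.valuationOfNeZero x)) :
    ∃ I : (FractionalIdeal R⁰ L)ˣ, I ^ n = toPrincipalIdeal R L x := by
  have hx : FractionalIdeal.spanSingleton R⁰ (x : L) ≠ 0 :=
    FractionalIdeal.spanSingleton_ne_zero_iff.mpr x.ne_zero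
  let e : HeightOneSpectrum R → ℤ := fun v =>
    FractionalIdeal.count L v (FractionalIdeal.spanSingleton R⁰ (x : L)) / n
  have he : ∀ᶠ v in Filter.cofinite, e v = 0 := by
    filter_upwards [FractionalIdeal.finite_factors (FractionalIdeal.spanSingleton R⁰ (x : L))]
      with v hv
    simp only [e, hv, Int.zero_ediv]
  let I : FractionalIdeal R⁰ L :=
    ∏ᶠ v : HeightOneSpectrum R, (v.asIdeal : FractionalIdeal R⁰ L) ^ e v
  have hI : I ≠ 0 := by
    refine finprod_induction (fun J : FractionalIdeal R⁰ L => J ≠ 0) one_ne_zero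
      (fun _ _ => mul_ne_zero) fun v => zpow_ne_zero _ ?_
    exact FractionalIdeal.coeIdeal_ne_zero.mpr v.ne_bot
  refine ⟨Units.mk0 I hI, Units.ext ?_⟩
  rw [Units.val_pow_eq_pow_val, Units.val_mk0, coe_toPrincipalIdeal]
  refine fractionalIdeal_eq_of_count_eq (pow_ne_zero _ hI) hx fun v => ?_
  rw [FractionalIdeal.count_pow, FractionalIdeal.count_finprod L v e he]
  refine Int.mul_ediv_cancel' ?_
  rw [count_spanSingleton_eq]
  exact (h v).neg_right

/-- An element generating the unit ideal comes from a unit of `R`. -/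
theorem exists_unit_of_toPrincipalIdeal_eq_one {R : Type*} [CommRing R] [IsDomain R]
    {L : Type*} [Field L] [Algebra R L] [IsFractionRing R L] (x : Lˣ) (h : toPrincipalIdeal R L x = 1) :
    ∃ u : Rˣ, Units.map (algebraMap R L : R →* L) u = x := by
  have key : ∀ y : Lˣ, toPrincipalIdeal R L y = 1 → ∃ r : R, algebraMap R L r = y := by
    intro y hy
    have h1 := congrArg Units.val hy
    rw [coe_toPrincipalIdeal, Units.val_one] at h1
    have h2 : (y : L) ∈ FractionalIdeal.spanSingleton R⁰ (y : L) :=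
      FractionalIdeal.mem_spanSingleton_self _ _
    rw [h1] at h2
    exact (FractionalIdeal.mem_one_iff _).mp h2
  obtain ⟨r, hr⟩ := key x h
  obtain ⟨s, hs⟩ := key x⁻¹ (by rw [map_inv, h, inv_one])
  have hrs : r * s = 1 := by
    apply IsFractionRing.injective R L
    rw [map_mul, hr, hs, map_one, Units.mul_inv]
  exact ⟨⟨r, s, hrs, by rw [mul_comm, hrs]⟩, Units.ext hr⟩

/-- A group is finite if it maps to a finite type with fibres in cosets of a finite subgroup. -/
@[to_additive]
theorem finite_of_map_eq_imp_inv_mul_mem {G X : Type*} [Group G] [Finite X] (H : Subgroup G)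
    [Finite H] (f : G → X) (hf : ∀ a b, f a = f b → a⁻¹ * b ∈ H) : Finite G := by
  have : Finite (G ⧸ H) := by
    refine Finite.of_injective (fun q : G ⧸ H => f q.out) fun p q hpq => ?_
    have := hf _ _ hpq
    rw [← QuotientGroup.eq, QuotientGroup.out_eq', QuotientGroup.out_eq'] at this
    exact this
  exact Finite.of_equiv _ (Subgroup.groupEquivQuotientProdSubgroup (s := H)).symm

theorem finite_selmerGroup_empty [Finite (ClassGroup R)] [Group.FG Rˣ] {n : ℕ} (hn : n ≠ 0) :
    Finite (selmerGroup (R := R) (K := L) (S := ∅) (n := n)) := by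
  have : Fact (0 < n) := ⟨Nat.pos_of_ne_zero hn⟩
  have hunits : Finite (selmerGroup.fromUnit (R := R) (K := L) (n := n)).range := by
    have : Finite (Rˣ ⧸ (powMonoidHom n : Rˣ →* Rˣ).range) := by
      refine CommGroup.finite_of_fg_isMulTorsion _ fun q => ?_
      obtain ⟨u, rfl⟩ := QuotientGroup.mk_surjective q
      refine isOfFinOrder_iff_pow_eq_one.mpr ⟨n, Nat.pos_of_ne_zero hn, ?_⟩
      rw [← QuotientGroup.mk_pow, QuotientGroup.eq_one_iff]
      exact ⟨u, rfl⟩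
    have h2 : Finite (Rˣ ⧸ (selmerGroup.fromUnit (R := R) (K := L) (n := n)).ker) := by
      rwa [selmerGroup.fromUnit_ker]
    exact Finite.of_equiv _ (QuotientGroup.quotientKerEquivRange _).toEquiv
  have hex : ∀ q : selmerGroup (R := R) (K := L) (S := ∅) (n := n),
      ∃ p : Lˣ × (FractionalIdeal R⁰ L)ˣ,
        (QuotientGroup.mk p.1 : Lˣ ⧸ (powMonoidHom n : Lˣ →* Lˣ).range) = q.1 ∧
        p.2 ^ n = toPrincipalIdeal R L p.1 := by
    rintro ⟨q, hq⟩
    obtain ⟨x, rfl⟩ := QuotientGroup.mk_surjective q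
    obtain ⟨I, hI⟩ := exists_pow_eq_toPrincipalIdeal x fun v =>
      (valuationOfNeZeroMod_mk_eq_one_iff v n x).mp (hq v (Set.notMem_empty v))
    exact ⟨(x, I), rfl, hI⟩
  choose p hp1 hp2 using hex
  have : Finite ((FractionalIdeal R⁰ L)ˣ ⧸ (toPrincipalIdeal R L).range) :=
    Finite.of_equiv _ (ClassGroup.equiv L).toEquiv
  refine finite_of_map_eq_imp_inv_mul_mem (selmerGroup.fromUnit (R := R) (K := L) (n := n)).range
    (fun q => (QuotientGroup.mk (p q).2 :
      (FractionalIdeal R⁰ L)ˣ ⧸ (toPrincipalIdeal R L).range)) fun q r hqr => ?_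
  have h2 : (p q).2⁻¹ * (p r).2 ∈ (toPrincipalIdeal R L).range := QuotientGroup.eq.mp hqr
  obtain ⟨y, hy⟩ := h2
  obtain ⟨u, hu⟩ := exists_unit_of_toPrincipalIdeal_eq_one (R := R)
    ((p q).1⁻¹ * (p r).1 * (y ^ n)⁻¹) (by
      rw [map_mul, map_mul, map_inv, map_inv, map_pow, hy, ← hp2, ← hp2, mul_pow, inv_pow,
        mul_inv_cancel])
  refine ⟨u, Subtype.ext ?_⟩
  rw [Subgroup.coe_mul, Subgroup.coe_inv, ← hp1 q, ← hp1 r, ← QuotientGroup.mk_inv,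
    ← QuotientGroup.mk_mul]
  refine QuotientGroup.eq.mpr ⟨y, ?_⟩
  have hu' : Units.map (algebraMap R L).toMonoidHom u = (p q).1⁻¹ * (p r).1 * (y ^ n)⁻¹ := hu
  rw [hu', powMonoidHom_apply]
  group

theorem finite_selmerGroup [Finite (ClassGroup R)] [Group.FG Rˣ] {n : ℕ} (hn : n ≠ 0)
    {S : Set (HeightOneSpectrum R)} (hS : S.Finite) :
    Finite (selmerGroup (R := R) (K := L) (S := S) (n := n)) := by
  have := hS.to_subtype
  have : NeZero n := ⟨hn⟩
  have : Finite (selmerGroup (R := R) (K := L) (S := ∅) (n := n)) := finite_selmerGroup_empty hn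
  have : Finite (selmerGroup.valuation (R := R) (K := L) (S := S) (n := n)).ker := by
    rw [selmerGroup.valuation_ker_eq]
    exact Finite.of_injective
      (fun q => (⟨q.1.1, q.2⟩ : selmerGroup (R := R) (K := L) (S := ∅) (n := n)))
      fun q r h => Subtype.ext (Subtype.ext (congrArg (fun z => z.1) h))
  have : Finite (Multiplicative (ZMod n)) := inferInstanceAs (Finite (ZMod n))
  refine finite_of_map_eq_imp_inv_mul_mem (selmerGroup.valuation (R := R) (K := L) (S := S)
    (n := n)).ker selmerGroup.valuation fun a b h => ?_
  rw [MonoidHom.mem_ker, map_mul, map_inv, h, inv_mul_cancel]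

end SelmerGroup

section Curve

open WeierstrassCurve.Affine

variable {k : Type*} [Field k] (W : WeierstrassCurve k)

theorem four_ne_zero_of_two {k : Type*} [Field k] (h2 : (2 : k) ≠ 0) : (4 : k) ≠ 0 := by
  have : (4 : k) = 2 * 2 := by norm_num
  rw [this]
  exact mul_ne_zero h2 h2

/-- The `y`-coordinate after completing the square. -/
noncomputable def centredY (x y : k) : k := y + (W.a₁ * x + W.a₃) / 2

/-- The coefficient `a` of the model `w² = u (u² + a u + b)` for which the two-torsion point with
`x`-coordinate `t` is the origin. -/
noncomputable def coeffA (t : k) : k := 3 * t + W.b₂ / 4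

/-- The coefficient `b` of the model `w² = u (u² + a u + b)` for which the two-torsion point with
`x`-coordinate `t` is the origin. -/
noncomputable def coeffB (t : k) : k := 3 * t ^ 2 + (W.b₂ * t + W.b₄) / 2

variable {W}

theorem equation_iff_centredY_sq (h2 : (2 : k) ≠ 0) (x y : k) :
    W.toAffine.Equation x y ↔
      centredY W x y ^ 2 = x ^ 3 + W.b₂ / 4 * x ^ 2 + W.b₄ / 2 * x + W.b₆ / 4 := by
  have h4 := four_ne_zero_of_two h2
  rw [equation_iff, ← sub_eq_zero, ← sub_eq_zero (b := _ + W.b₆ / 4)]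
  have : centredY W x y ^ 2 - (x ^ 3 + W.b₂ / 4 * x ^ 2 + W.b₄ / 2 * x + W.b₆ / 4) =
      y ^ 2 + W.a₁ * x * y + W.a₃ * y - (x ^ 3 + W.a₂ * x ^ 2 + W.a₄ * x + W.a₆) := by
    simp only [centredY, WeierstrassCurve.b₂, WeierstrassCurve.b₄, WeierstrassCurve.b₆]
    field_simp
    ring
  rw [this]

theorem centredY_negY (h2 : (2 : k) ≠ 0) (x y : k) :
    centredY W x (W.toAffine.negY x y) = -centredY W x y := by
  simp only [centredY, negY]
  field_simp
  ring

theorem centredY_injective {x y y' : k} (h : centredY W x y = centredY W x y') : y = y' :=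
  add_right_cancel h

theorem eq_negY_iff (h2 : (2 : k) ≠ 0) (x y : k) :
    y = W.toAffine.negY x y ↔ centredY W x y = 0 := by
  constructor
  · intro h
    have h1 := centredY_negY (W := W) h2 x y
    rw [← h] at h1
    have h3 : 2 * centredY W x y = 0 := by linear_combination h1
    exact (mul_eq_zero.mp h3).resolve_left h2
  · intro h
    apply centredY_injective (W := W) (x := x)
    rw [centredY_negY h2, h, neg_zero]

section Model

variable {t s : k} (hT : W.toAffine.Equation t s) (hs : centredY W t s = 0)

include hT hs

theorem centredY_sq_eq (h2 : (2 : k) ≠ 0) {x y : k} (h : W.toAffine.Equation x y) :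
    centredY W x y ^ 2 = (x - t) * ((x - t) ^ 2 + coeffA W t * (x - t) + coeffB W t) := by
  rw [equation_iff_centredY_sq h2] at h hT
  have h4 := four_ne_zero_of_two h2
  rw [hs] at hT
  simp only [coeffA, coeffB]
  have h24 : (2 : k)⁻¹ = 2 * 4⁻¹ := by field_simp; norm_num
  linear_combination h - hT - W.b₂ * t * (x - t) * h24

theorem equation_of_centredY_sq_eq (h2 : (2 : k) ≠ 0) {x y : k}
    (h : centredY W x y ^ 2 = (x - t) * ((x - t) ^ 2 + coeffA W t * (x - t) + coeffB W t)) :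
    W.toAffine.Equation x y := by
  rw [equation_iff_centredY_sq h2] at hT ⊢
  rw [hs] at hT
  rw [h]
  simp only [coeffA, coeffB]
  have h4 := four_ne_zero_of_two h2
  have h24 : (2 : k)⁻¹ = 2 * 4⁻¹ := by field_simp; norm_num
  linear_combination hT + W.b₂ * t * (x - t) * h24

theorem discr_eq (h2 : (2 : k) ≠ 0) :
    W.Δ = 16 * coeffB W t ^ 2 * (coeffA W t ^ 2 - 4 * coeffB W t) := by
  have h4 := four_ne_zero_of_two h2
  rw [equation_iff_centredY_sq h2, hs] at hT
  have hb6 : W.b₆ = -4 * (t ^ 3 + W.b₂ / 4 * t ^ 2 + W.b₄ / 2 * t) := by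
    have : W.b₆ = 4 * (W.b₆ / 4) := by field_simp
    rw [this]
    linear_combination 4 * (-hT)
  have hb8 : W.b₈ = (W.b₂ * W.b₆ - W.b₄ ^ 2) / 4 := by
    rw [eq_div_iff h4]
    linear_combination W.b_relation
  rw [WeierstrassCurve.Δ, hb8, hb6]
  simp only [coeffA, coeffB]
  field_simp
  ring

theorem coeffB_ne_zero [W.IsElliptic] (h2 : (2 : k) ≠ 0) : coeffB W t ≠ 0 := by
  intro h
  apply W.isUnit_Δ.ne_zero
  rw [discr_eq hT hs h2, h]
  ring

theorem coeffA_sq_sub_ne_zero [W.IsElliptic] (h2 : (2 : k) ≠ 0) :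
    coeffA W t ^ 2 - 4 * coeffB W t ≠ 0 := by
  intro h
  apply W.isUnit_Δ.ne_zero
  rw [discr_eq hT hs h2, h]
  ring

end Model

/-- Translation by a two-torsion point. -/
theorem add_twoTorsion_eq (h2 : (2 : k) ≠ 0) {t s x y : k} (hT : W.toAffine.Nonsingular t s)
    (hs : centredY W t s = 0) (hP : W.toAffine.Nonsingular x y) (hx : x ≠ t) :
    ∃ (x' y' : k) (h' : W.toAffine.Nonsingular x' y'),
      (Point.some x y hP + Point.some t s hT : W.toAffine.Point) = .some x' y' h' ∧
      (x - t) * (x' - t) = coeffB W t ∧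
      (x - t) ^ 2 * centredY W x' y' = -(coeffB W t * centredY W x y) := by
  have hu : x - t ≠ 0 := sub_ne_zero.mpr hx
  have hw := centredY_sq_eq hT.1 hs h2 hP.1
  refine ⟨_, _, _, Point.add_of_X_ne hx, ?_⟩
  have hl : W.toAffine.slope x t y s = centredY W x y / (x - t) - W.a₁ / 2 := by
    rw [slope_of_X_ne hx]
    have hs' : s = -(W.a₁ * t + W.a₃) / 2 := by
      simp only [centredY] at hs
      linear_combination hs
    rw [hs']
    simp only [centredY]
    field_simp
    ring
  rw [hl]
  generalize hwd : centredY W x y = w at *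
  have hy : y = w - (W.a₁ * x + W.a₃) / 2 := by
    rw [← hwd]; simp only [centredY]; ring
  have h4 := four_ne_zero_of_two h2
  have hX : (x - t) * (W.toAffine.addX x t (w / (x - t) - W.a₁ / 2) - t) = coeffB W t := by
    have : (x - t) * ((x - t) * (W.toAffine.addX x t (w / (x - t) - W.a₁ / 2) - t)) =
        w ^ 2 - (x - t) ^ 2 * (x - t + coeffA W t) := by
      simp only [addX, coeffA, WeierstrassCurve.b₂]
      field_simp
      ring
    apply mul_left_cancel₀ hu
    rw [this, hw]
    ring
  refine ⟨hX, ?_⟩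
  have hX' : W.toAffine.addX x t (w / (x - t) - W.a₁ / 2) = t + coeffB W t / (x - t) := by
    rw [eq_add_of_sub_eq' (eq_div_of_mul_eq hu ((mul_comm _ _).trans hX))]
  simp only [addY, negAddY, centredY, negY]
  rw [hX', hy]
  field_simp
  ring

theorem two_nsmul_some_eq_zero_iff (h2 : (2 : k) ≠ 0) {x y : k} (h : W.toAffine.Nonsingular x y) :
    2 • (Point.some x y h : W.toAffine.Point) = 0 ↔ centredY W x y = 0 := by
  rw [two_nsmul, ← eq_negY_iff h2]
  constructor
  · intro h0
    by_contra hne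
    rw [Point.add_self_of_Y_ne hne] at h0
    exact Point.some_ne_zero _ h0
  · exact fun h0 => Point.add_self_of_Y_eq h0

theorem exists_eq_some_of_two_nsmul (h2 : (2 : k) ≠ 0) {T : W.toAffine.Point} (hT : 2 • T = 0)
    (hT0 : T ≠ 0) :
    ∃ (t s : k) (h : W.toAffine.Nonsingular t s), T = .some t s h ∧ centredY W t s = 0 := by
  rcases T with _ | ⟨t, s, h⟩
  · exact absurd rfl hT0
  · exact ⟨t, s, h, rfl, (two_nsmul_some_eq_zero_iff h2 h).mp hT⟩

theorem some_eq_some_of_centredY {x y x' y' : k} {h : W.toAffine.Nonsingular x y}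
    {h' : W.toAffine.Nonsingular x' y'} (hx : x = x') (hw : centredY W x y = centredY W x' y') :
    (Point.some x y h : W.toAffine.Point) = .some x' y' h' := by
  subst hx
  obtain rfl := centredY_injective hw
  rfl

/-- Over an algebraically closed field, a two-torsion point can be halved. -/
theorem exists_two_nsmul_eq [IsAlgClosed k] [W.IsElliptic] (h2 : (2 : k) ≠ 0)
    {T : W.toAffine.Point} (hT : 2 • T = 0) (hT0 : T ≠ 0) :
    ∃ R : W.toAffine.Point, 2 • R = T := by
  obtain ⟨t, s, h, rfl, hs⟩ := exists_eq_some_of_two_nsmul h2 hT hT0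
  obtain ⟨u, hu⟩ := IsAlgClosed.exists_pow_nat_eq (coeffB W t) (n := 2) two_pos
  obtain ⟨w, hw⟩ := IsAlgClosed.exists_pow_nat_eq
    (u * (u ^ 2 + coeffA W t * u + coeffB W t)) (n := 2) two_pos
  have hb := coeffB_ne_zero h.1 hs h2
  have hu0 : u ≠ 0 := by
    rintro rfl
    exact hb (by rw [← hu]; ring)
  have hwy : centredY W (u + t) (w - (W.a₁ * (u + t) + W.a₃) / 2) = w := by
    simp only [centredY]; ring
  have hR : W.toAffine.Nonsingular (u + t) (w - (W.a₁ * (u + t) + W.a₃) / 2) := by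
    refine equation_iff_nonsingular.mp (equation_of_centredY_sq_eq h.1 hs h2 ?_)
    rw [hwy, hw]; ring
  refine ⟨.some _ _ hR, ?_⟩
  obtain ⟨x', y', h', hadd, hx', hy'⟩ := add_twoTorsion_eq h2 h hs hR (by simpa using hu0)
  rw [add_sub_cancel_right] at hx' hy'
  have hneg : (Point.some _ _ hR + Point.some t s h : W.toAffine.Point) = -Point.some _ _ hR := by
    rw [hadd, Point.neg_some]
    refine some_eq_some_of_centredY ?_ ?_
    · apply mul_left_cancel₀ hu0
      linear_combination hx' - hu
    · rw [centredY_negY h2, hwy]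
      apply mul_left_cancel₀ (pow_ne_zero 2 hu0)
      rw [hy', hwy, hu]
      ring
  rw [two_nsmul]
  have h3 : (Point.some t s h : W.toAffine.Point) + Point.some t s h = 0 := by
    rw [← two_nsmul]; exact hT
  have h4 : (Point.some t s h : W.toAffine.Point) = -Point.some t s h :=
    eq_neg_of_add_eq_zero_left h3
  rw [h4, ← sub_eq_zero, sub_neg_eq_add, add_assoc, hneg, add_neg_cancel]

/-- Over an algebraically closed field, there is more than one point of order two. -/
theorem exists_twoTorsion_ne [IsAlgClosed k] [W.IsElliptic] (h2 : (2 : k) ≠ 0)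
    {T : W.toAffine.Point} (hT : 2 • T = 0) (hT0 : T ≠ 0) :
    ∃ S : W.toAffine.Point, 2 • S = 0 ∧ S ≠ 0 ∧ S ≠ T := by
  obtain ⟨t, s, h, rfl, hs⟩ := exists_eq_some_of_two_nsmul h2 hT hT0
  obtain ⟨d, hd⟩ := IsAlgClosed.exists_pow_nat_eq (coeffA W t ^ 2 - 4 * coeffB W t) (n := 2) two_pos
  have hb := coeffB_ne_zero h.1 hs h2
  have h4 := four_ne_zero_of_two h2
  obtain ⟨u, hu⟩ : ∃ u : k, u ^ 2 + coeffA W t * u + coeffB W t = 0 := by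
    refine ⟨(d - coeffA W t) / 2, ?_⟩
    field_simp
    linear_combination hd
  have hu0 : u ≠ 0 := by
    rintro rfl
    exact hb (by linear_combination hu)
  have hwy : centredY W (u + t) (-((W.a₁ * (u + t) + W.a₃) / 2)) = 0 := by
    simp only [centredY]; ring
  have hR : W.toAffine.Nonsingular (u + t) (-((W.a₁ * (u + t) + W.a₃) / 2)) := by
    refine equation_iff_nonsingular.mp (equation_of_centredY_sq_eq h.1 hs h2 ?_)
    rw [hwy, add_sub_cancel_right, hu]; ring
  refine ⟨.some _ _ hR, (two_nsmul_some_eq_zero_iff h2 hR).mpr hwy, Point.some_ne_zero _, ?_⟩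
  intro heq
  have := (Point.some.inj heq).1
  exact hu0 (by linear_combination this)

/-- There are at most four two-torsion points. -/
theorem twoTorsion_eq_or (h2 : (2 : k) ≠ 0) {T P Q : W.toAffine.Point} (hT : 2 • T = 0)
    (hT0 : T ≠ 0) (hQ : 2 • Q = 0) (hQ0 : Q ≠ 0) (hQT : Q ≠ T) (hP : 2 • P = 0) :
    P = 0 ∨ P = T ∨ P = Q ∨ P = Q + T := by
  by_cases hP0 : P = 0
  · exact .inl hP0
  by_cases hPT : P = T
  · exact .inr (.inl hPT)
  refine .inr (.inr ?_)
  obtain ⟨t, s, h, rfl, hs⟩ := exists_eq_some_of_two_nsmul h2 hT hT0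
  have key : ∀ (x y : k) (h' : W.toAffine.Nonsingular x y), centredY W x y = 0 →
      (Point.some x y h' : W.toAffine.Point) ≠ .some t s h →
      x ≠ t ∧ (x - t) ^ 2 + coeffA W t * (x - t) + coeffB W t = 0 := by
    intro x y h' hw hne
    have hx : x ≠ t := fun hx => hne (some_eq_some_of_centredY hx (by rw [hw, hs]))
    refine ⟨hx, ?_⟩
    have := centredY_sq_eq h.1 hs h2 h'.1
    rw [hw, zero_pow two_ne_zero] at this
    exact (mul_eq_zero.mp this.symm).resolve_left (sub_ne_zero.mpr hx)
  obtain ⟨x, y, hxy, rfl, hw⟩ := exists_eq_some_of_two_nsmul h2 hP hP0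
  obtain ⟨x₁, y₁, hxy₁, rfl, hw₁⟩ := exists_eq_some_of_two_nsmul h2 hQ hQ0
  obtain ⟨hx, hu⟩ := key _ _ _ hw hPT
  obtain ⟨hx₁, hu₁⟩ := key _ _ _ hw₁ hQT
  by_cases hxx : x = x₁
  · exact .inl (some_eq_some_of_centredY hxx (by rw [hw, hw₁]))
  · right
    obtain ⟨x', y', h', hadd, hx', hy'⟩ := add_twoTorsion_eq h2 h hs hxy₁ hx₁
    rw [hadd]
    have hu0 : x₁ - t ≠ 0 := sub_ne_zero.mpr hx₁
    have hsum : (x - t) + (x₁ - t) + coeffA W t = 0 := by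
      apply mul_left_cancel₀ (sub_ne_zero.mpr hxx)
      linear_combination hu - hu₁
    refine some_eq_some_of_centredY ?_ ?_
    · apply mul_left_cancel₀ hu0
      linear_combination hu₁ * (-1) + (x₁ - t) * hsum - hx'
    · rw [hw]
      rw [hw₁, mul_zero, neg_zero] at hy'
      exact ((mul_eq_zero.mp hy').resolve_left (pow_ne_zero 2 hu0)).symm

end Curve

section GaloisDescent

variable {F : Type u} [Field F] [CharZero F]

theorem exists_algebraMap_eq_of_fixed {x : AlgebraicClosure F} (h : ∀ σ : GalAbs F, σ x = x) :
    ∃ y : F, algebraMap F (AlgebraicClosure F) y = x :=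
  (InfiniteGalois.mem_range_algebraMap_iff_fixed x).mpr h

/-- An open subgroup of index at most two of the absolute Galois group is the stabilizer of a
square root. -/
theorem exists_sqrt_of_index_two (H : Subgroup (GalAbs F)) (hH : IsOpen (H : Set (GalAbs F)))
    (h2 : ∀ σ τ, σ ∉ H → τ ∉ H → σ * τ ∈ H) :
    ∃ z : AlgebraicClosure F, z ≠ 0 ∧ ∀ σ : GalAbs F, (σ ∈ H ∧ σ z = z) ∨ (σ ∉ H ∧ σ z = -z) := by
  by_cases htop : H = ⊤
  · exact ⟨1, one_ne_zero, fun σ => .inl ⟨htop ▸ Subgroup.mem_top σ, map_one σ⟩⟩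
  have hconj : ∀ g h, g ∉ H → h ∈ H → g⁻¹ * h * g ∈ H := by
    intro g h hg hh
    rw [mul_assoc]
    refine h2 _ _ (fun hg' => hg (by simpa using H.inv_mem hg')) fun hhg => hg ?_
    simpa using H.mul_mem (H.inv_mem hh) hhg
  have hfix := InfiniteGalois.fixingSubgroup_fixedField
    (k := F) (K := AlgebraicClosure F) ⟨H, H.isClosed_of_isOpen hH⟩
  obtain ⟨σ₀, hσ₀⟩ : ∃ σ₀, σ₀ ∉ H := by
    by_contra! hall
    exact htop ((Subgroup.eq_top_iff' H).mpr hall)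
  obtain ⟨x, hx, hx₀⟩ : ∃ x ∈ IntermediateField.fixedField H, σ₀ x ≠ x := by
    by_contra! hall
    apply hσ₀
    have : σ₀ ∈ (IntermediateField.fixedField H).fixingSubgroup :=
      (IntermediateField.mem_fixingSubgroup_iff _ _).mpr hall
    rw [hfix] at this
    exact this
  have hxH : ∀ σ ∈ H, σ x = x := fun σ hσ => hx ⟨σ, hσ⟩
  have hσ₀x : ∀ σ ∉ H, σ x = σ₀ x := by
    intro σ hσ
    have := hxH (σ₀⁻¹ * σ) (h2 _ _ (fun h => hσ₀ (by simpa using H.inv_mem h)) hσ)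
    have h3 := congrArg σ₀ this
    rwa [← AlgEquiv.mul_apply, mul_inv_cancel_left] at h3
  refine ⟨x - σ₀ x, sub_ne_zero.mpr hx₀.symm, fun σ => ?_⟩
  by_cases hσ : σ ∈ H
  · refine .inl ⟨hσ, ?_⟩
    have h3 := hxH _ (hconj σ₀ σ hσ₀ hσ)
    have h4 := congrArg σ₀ h3
    rw [← AlgEquiv.mul_apply, mul_assoc, mul_inv_cancel_left, AlgEquiv.mul_apply] at h4
    rw [map_sub, hxH σ hσ, h4]
  · refine .inr ⟨hσ, ?_⟩
    have h3 := hxH _ (h2 σ σ₀ hσ hσ₀)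
    rw [AlgEquiv.mul_apply] at h3
    rw [map_sub, hσ₀x σ hσ, h3, neg_sub]

/-- If the Galois action on a point of `w² = u (u² + a u + b)` is through translation by the origin,
then the corresponding square class comes from a point of `Y² = X (X² - 2 a X + a² - 4 b)`. -/
theorem exists_squareClass_of_translate {a b d : F} {u w z : AlgebraicClosure F}
    (hu : u ≠ 0) (hb : b ≠ 0) (hab : a ^ 2 - 4 * b ≠ 0)
    (hw : w ^ 2 = u * (u ^ 2 + algebraMap _ _ a * u + algebraMap _ _ b))
    (hz : z ^ 2 = algebraMap _ _ d)
    (hσ : ∀ σ : GalAbs F, (σ u = u ∧ σ w = w ∧ σ z = z) ∨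
      (u * σ u = algebraMap _ _ b ∧ u ^ 2 * σ w = -(algebraMap _ _ b * w) ∧ σ z = -z)) :
    ∃ e m : F, e ≠ 0 ∧ d * e = m ^ 2 ∧
      (e = a ^ 2 - 4 * b ∨ ∃ y, y ^ 2 = e * (e ^ 2 - 2 * a * e + (a ^ 2 - 4 * b))) := by
  have hinj := (algebraMap F (AlgebraicClosure F)).injective
  have hb' : algebraMap F (AlgebraicClosure F) b ≠ 0 := by
    rwa [ne_eq, FaithfulSMul.algebraMap_eq_zero_iff]
  by_cases hw0 : w = 0
  · have hquad : u ^ 2 + algebraMap _ _ a * u + algebraMap _ _ b = 0 := by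
      rw [hw0, zero_pow two_ne_zero] at hw
      exact (mul_eq_zero.mp hw.symm).resolve_left hu
    obtain ⟨m, hm⟩ := exists_algebraMap_eq_of_fixed (x := z * (u - algebraMap _ _ b / u)) (by
      intro σ
      rcases hσ σ with ⟨h1, -, h3⟩ | ⟨h1, -, h3⟩
      · rw [map_mul, map_sub, map_div₀, AlgEquiv.commutes, h1, h3]
      · have h4 : σ u = algebraMap _ _ b / u := by rw [eq_div_iff hu, mul_comm, h1]
        rw [map_mul, map_sub, map_div₀, AlgEquiv.commutes, h4, h3]
        field_simp
        ring)
    refine ⟨a ^ 2 - 4 * b, m, hab, hinj ?_, .inl rfl⟩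
    rw [map_mul, map_pow, hm, ← hz, map_sub, map_mul, map_pow, mul_pow]
    have h5 : algebraMap F (AlgebraicClosure F) a = -(u + algebraMap _ _ b / u) := by
      field_simp
      linear_combination hquad
    have h6 : algebraMap F (AlgebraicClosure F) 4 = 4 := map_ofNat _ 4
    rw [h5, h6]
    field_simp
    ring
  · have hg : ∀ σ : GalAbs F, (σ u = u ∧ σ (w / u) = w / u ∧ σ z = z) ∨
        (σ u = algebraMap _ _ b / u ∧ σ (w / u) = -(w / u) ∧ σ z = -z) := by
      intro σ
      rcases hσ σ with ⟨h1, h2, h3⟩ | ⟨h1, h2, h3⟩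
      · exact .inl ⟨h1, by rw [map_div₀, h1, h2], h3⟩
      · have h4 : σ u = algebraMap _ _ b / u := by rw [eq_div_iff hu, mul_comm, h1]
        have h5 : σ w = -(algebraMap _ _ b * w) / u ^ 2 := by
          rw [eq_div_iff (pow_ne_zero 2 hu), mul_comm, h2]
        refine .inr ⟨h4, ?_, h3⟩
        rw [map_div₀, h4, h5]
        field_simp
    obtain ⟨m, hm⟩ := exists_algebraMap_eq_of_fixed (x := z * (w / u)) (by
      intro σ
      rcases hg σ with ⟨-, h2, h3⟩ | ⟨-, h2, h3⟩ <;> rw [map_mul, h2, h3]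
      ring)
    obtain ⟨e, he⟩ := exists_algebraMap_eq_of_fixed (x := (w / u) ^ 2) (by
      intro σ
      rcases hg σ with ⟨-, h2, -⟩ | ⟨-, h2, -⟩ <;> rw [map_pow, h2]
      ring)
    obtain ⟨y, hy⟩ := exists_algebraMap_eq_of_fixed
      (x := (w / u) * (u - algebraMap _ _ b / u)) (by
      intro σ
      rcases hg σ with ⟨h1, h2, -⟩ | ⟨h1, h2, -⟩ <;>
        rw [map_mul, map_sub, h2, map_div₀, AlgEquiv.commutes, h1]
      field_simp
      ring)
    refine ⟨e, m, ?_, hinj ?_, .inr ⟨y, hinj ?_⟩⟩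
    · rintro rfl
      rw [map_zero] at he
      exact pow_ne_zero 2 (div_ne_zero hw0 hu) he.symm
    · rw [map_mul, map_pow, hm, he, ← hz]
      ring
    · have he' : algebraMap F (AlgebraicClosure F) e =
          u + algebraMap _ _ a + algebraMap _ _ b / u := by
        rw [he, div_pow, hw]
        field_simp
      simp only [map_mul, map_pow, map_add, map_sub, hy, map_ofNat]
      rw [mul_pow, ← he, he']
      field_simp
      ring

end GaloisDescent

section Valuation

theorem isSquare_valuation_of_sq_eq {F Γ : Type*} [Field F] [LinearOrderedCommGroupWithZero Γ]
    (v : Valuation F Γ) {a δ e y : F} (ha : v a ≤ 1) (hδ : v δ = 1) (he : e ≠ 0)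
    (h : y ^ 2 = e * (e ^ 2 - 2 * a * e + δ)) : IsSquare (v e) := by
  have h2a : v (2 * a) ≤ 1 := by
    rw [map_mul]
    refine mul_le_one' ?_ ha
    rw [← one_add_one_eq_two]
    exact (v.map_add _ _).trans (by simp)
  have hve : v e ≠ 0 := (Valuation.ne_zero_iff v).mpr he
  have hv := congrArg v h
  rw [map_pow, map_mul] at hv
  rcases lt_trichotomy (v e) 1 with hlt | heq | hgt
  · have h1 : v (e ^ 2 - 2 * a * e + δ) = 1 := by
      rw [Valuation.map_add_eq_of_lt_right, hδ]
      rw [hδ]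
      refine (v.map_sub _ _).trans_lt (max_lt ?_ ?_)
      · rw [map_pow]
        exact pow_lt_one₀ zero_le hlt two_ne_zero
      · rw [map_mul]
        exact (mul_le_of_le_one_left' h2a).trans_lt hlt
    rw [h1, mul_one] at hv
    exact ⟨v y, by rw [← hv, sq]⟩
  · rw [heq]; exact ⟨1, (one_mul 1).symm⟩
  · have h1 : v (e ^ 2 - 2 * a * e + δ) = v e ^ 2 := by
      have h3 : v e < v e ^ 2 := by
        rw [sq]; exact lt_mul_of_one_lt_left (zero_lt_iff.mpr hve) hgt
      have h4 : v (-(2 * a * e) + δ) < v (e ^ 2) := by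
        rw [map_pow]
        refine (v.map_add _ _).trans_lt (max_lt ?_ ?_)
        · rw [Valuation.map_neg, map_mul]
          exact (mul_le_of_le_one_left' h2a).trans_lt h3
        · rw [hδ]; exact hgt.trans h3
      have h5 : e ^ 2 - 2 * a * e + δ = e ^ 2 + (-(2 * a * e) + δ) := by ring
      rw [h5, Valuation.map_add_eq_of_lt_left v h4, map_pow]
    rw [h1] at hv
    refine ⟨v y / v e, ?_⟩
    rw [← sq, div_pow, hv, mul_div_cancel_right₀ _ (pow_ne_zero 2 hve)]

end Valuation

section BaseChange

variable {K : Type u} [Field K] (E : WeierstrassCurve K)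

instance isElliptic_baseChange [E.IsElliptic] (L : Type*) [Field L] [Algebra K L] :
    (E.baseChange L).IsElliptic :=
  inferInstanceAs (E.map (algebraMap K L)).IsElliptic

theorem coeffA_baseChange (L : Type*) [Field L] [Algebra K L] (t : K) :
    coeffA (E.baseChange L) (algebraMap K L t) = algebraMap K L (coeffA E t) := by
  simp [coeffA, WeierstrassCurve.baseChange, map_ofNat]

theorem coeffB_baseChange (L : Type*) [Field L] [Algebra K L] (t : K) :
    coeffB (E.baseChange L) (algebraMap K L t) = algebraMap K L (coeffB E t) := by
  simp [coeffB, WeierstrassCurve.baseChange, map_ofNat]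

theorem centredY_baseChange (L : Type*) [Field L] [Algebra K L] (x y : K) :
    centredY (E.baseChange L) (algebraMap K L x) (algebraMap K L y) =
      algebraMap K L (centredY E x y) := by
  simp [centredY, WeierstrassCurve.baseChange, map_ofNat]

theorem GalAbs.commutes_base {F : Type u} [Field F] [Algebra K F] (σ : GalAbs F) (x : K) :
    σ (algebraMap K (AlgebraicClosure F) x) = algebraMap K (AlgebraicClosure F) x := by
  rw [IsScalarTower.algebraMap_apply K F (AlgebraicClosure F), AlgEquiv.commutes]

theorem centredY_smul {F : Type u} [Field F] [Algebra K F] (σ : GalAbs F)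
    (x y : AlgebraicClosure F) :
    centredY (E.baseChange (AlgebraicClosure F)) (σ x) (σ y) =
      σ (centredY (E.baseChange (AlgebraicClosure F)) x y) := by
  simp [centredY, WeierstrassCurve.baseChange, GalAbs.commutes_base, map_ofNat]

/-- A point fixed by the Galois group is rational. -/
theorem exists_baseChange_eq_of_fixed {F : Type u} [Field F] [Algebra K F] [CharZero F]
    {E : WeierstrassCurve K} {P : Pts E (AlgebraicClosure F)} (h : ∀ σ : GalAbs F, σ • P = P) :
    ∃ Q : Pts E F, WeierstrassCurve.Affine.Point.baseChange F (AlgebraicClosure F) Q = P := by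
  rcases P with _ | ⟨x, y, hxy⟩
  · exact ⟨0, map_zero _⟩
  · have hfix : ∀ σ : GalAbs F, σ x = x ∧ σ y = y := fun σ =>
      (WeierstrassCurve.Affine.Point.some.injEq ..).mp (h σ)
    obtain ⟨x, rfl⟩ := exists_algebraMap_eq_of_fixed fun σ => (hfix σ).1
    obtain ⟨y, rfl⟩ := exists_algebraMap_eq_of_fixed fun σ => (hfix σ).2
    exact ⟨.some x y ((E.toAffine.baseChange_nonsingular
      (Algebra.ofId F (AlgebraicClosure F)).injective x y).mp hxy), rfl⟩

theorem smul_baseChange {F : Type u} [Field F] [Algebra K F] {E : WeierstrassCurve K}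
    (σ : GalAbs F) (P : Pts E F) :
    σ • (WeierstrassCurve.Affine.Point.baseChange F (AlgebraicClosure F) P :
      Pts E (AlgebraicClosure F)) =
      WeierstrassCurve.Affine.Point.baseChange F (AlgebraicClosure F) P := by
  rcases P with _ | ⟨x, y, hxy⟩
  · rfl
  · exact (WeierstrassCurve.Affine.Point.some.injEq ..).mpr ⟨σ.commutes x, σ.commutes y⟩

end BaseChange

section Local

variable {K : Type u} [Field K] [CharZero K] {F : Type u} [Field F] [Algebra K F]

theorem exists_squareClass_of_smul_sub_mem {E : WeierstrassCurve K} [E.IsElliptic] {t s : K}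
    (hT : (E.baseChange (AlgebraicClosure F)).toAffine.Nonsingular
      (algebraMap K (AlgebraicClosure F) t) (algebraMap K (AlgebraicClosure F) s))
    (hs : centredY E t s = 0) (R : Pts E (AlgebraicClosure F)) {z : AlgebraicClosure F} {d : K}
    (hz : z ^ 2 = algebraMap K (AlgebraicClosure F) d)
    (hσ : ∀ σ : GalAbs F, (σ • R = R ∧ σ z = z) ∨ (σ • R = R + .some _ _ hT ∧ σ z = -z)) :
    ∃ e m : F, e ≠ 0 ∧ algebraMap K F d * e = m ^ 2 ∧
      (e = 1 ∨ e = algebraMap K F (coeffA E t ^ 2 - 4 * coeffB E t) ∨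
        ∃ y, y ^ 2 = e * (e ^ 2 - 2 * algebraMap K F (coeffA E t) * e +
          algebraMap K F (coeffA E t ^ 2 - 4 * coeffB E t))) := by
  have : CharZero F := charZero_of_injective_algebraMap (algebraMap K F).injective
  have h2 : (2 : AlgebraicClosure F) ≠ 0 := two_ne_zero
  have hs' : centredY (E.baseChange (AlgebraicClosure F)) (algebraMap K (AlgebraicClosure F) t)
      (algebraMap K (AlgebraicClosure F) s) = 0 := by
    rw [centredY_baseChange, hs, map_zero]
  have htower := IsScalarTower.algebraMap_apply K F (AlgebraicClosure F)
  have hfixed : (∀ σ : GalAbs F, σ • R = R) → ∃ e m : F, e ≠ 0 ∧ algebraMap K F d * e = m ^ 2 ∧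
      (e = 1 ∨ e = algebraMap K F (coeffA E t ^ 2 - 4 * coeffB E t) ∨
        ∃ y, y ^ 2 = e * (e ^ 2 - 2 * algebraMap K F (coeffA E t) * e +
          algebraMap K F (coeffA E t ^ 2 - 4 * coeffB E t))) := by
    intro hR
    obtain ⟨m, hm⟩ := exists_algebraMap_eq_of_fixed (x := z) fun σ => by
      rcases hσ σ with ⟨-, h⟩ | ⟨h, -⟩
      · exact h
      · rw [hR σ, left_eq_add] at h
        exact absurd h (WeierstrassCurve.Affine.Point.some_ne_zero _)
    refine ⟨1, m, one_ne_zero, ?_, .inl rfl⟩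
    apply (algebraMap F (AlgebraicClosure F)).injective
    rw [mul_one, map_pow, hm, hz, htower]
  rcases R with _ | ⟨x, y, hxy⟩
  · exact hfixed fun σ => rfl
  by_cases hx : x = algebraMap K (AlgebraicClosure F) t
  · apply hfixed
    have hw := centredY_sq_eq hT.1 hs' h2 hxy.1
    rw [hx, sub_self, zero_mul, sq_eq_zero_iff] at hw
    have hy : y = algebraMap K (AlgebraicClosure F) s :=
      centredY_injective (hw.trans hs'.symm)
    intro σ
    refine (WeierstrassCurve.Affine.Point.some.injEq ..).mpr ⟨?_, ?_⟩
    · rw [hx]; exact GalAbs.commutes_base σ t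
    · rw [hy]; exact GalAbs.commutes_base σ s
  · obtain ⟨x', y', h', hadd, hx', hy'⟩ := add_twoTorsion_eq h2 hT hs' hxy hx
    have hw := centredY_sq_eq hT.1 hs' h2 hxy.1
    have hb := coeffB_ne_zero hT.1 hs' h2
    have hab := coeffA_sq_sub_ne_zero hT.1 hs' h2
    rw [coeffB_baseChange] at hx' hy' hb
    rw [coeffA_baseChange, coeffB_baseChange, htower (coeffA E t), htower (coeffB E t)] at hw hab
    rw [htower (coeffB E t)] at hx' hy' hb
    obtain ⟨e, m, he, hm, h⟩ := exists_squareClass_of_translate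
      (a := algebraMap K F (coeffA E t)) (b := algebraMap K F (coeffB E t))
      (d := algebraMap K F d) (z := z) (sub_ne_zero.mpr hx)
      (fun h => hb (by rw [h, map_zero]))
      (fun h => hab (by rw [← map_pow, ← map_ofNat (algebraMap F (AlgebraicClosure F)) 4,
        ← map_mul, ← map_sub, h, map_zero])) hw (by rw [hz, htower]) (by
        intro σ
        rcases hσ σ with ⟨h1, h2⟩ | ⟨h1, h2⟩
        · obtain ⟨h3, h4⟩ := (WeierstrassCurve.Affine.Point.some.injEq ..).mp h1
          refine .inl ⟨?_, ?_, h2⟩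
          · rw [map_sub, GalAbs.commutes_base]
            exact congrArg (· - _) h3
          · rw [← centredY_smul]
            exact congrArg₂ _ h3 h4
        · rw [hadd] at h1
          obtain ⟨h3, h4⟩ := (WeierstrassCurve.Affine.Point.some.injEq ..).mp h1
          have h3 : σ x = x' := h3
          have h4 : σ y = y' := h4
          refine .inr ⟨?_, ?_, h2⟩
          · rw [map_sub, GalAbs.commutes_base, h3, hx']
          · rw [← centredY_smul, h3, h4, hy'])
    refine ⟨e, m, he, hm, .inr ?_⟩
    simpa only [map_sub, map_pow, map_mul, map_ofNat] using h

end Local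

section SquareClass

open IsDedekindDomain

variable {K : Type u} [Field K] [NumberField K]

theorem valued_algebraMap_eq (v : HeightOneSpectrum (𝓞 K)) (x : K) :
    Valued.v (algebraMap K (v.adicCompletion K) x) = v.valuation K x :=
  HeightOneSpectrum.adicCompletion.valued_coe K v x

theorem isSquare_valuation_of_smul_sub_mem (v : HeightOneSpectrum (𝓞 K)) {E : WeierstrassCurve K}
    [E.IsElliptic] {t s : K}
    (hT : (E.baseChange (AlgebraicClosure (v.adicCompletion K))).toAffine.Nonsingular
      (algebraMap K (AlgebraicClosure (v.adicCompletion K)) t)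
      (algebraMap K (AlgebraicClosure (v.adicCompletion K)) s))
    (hs : centredY E t s = 0) (R : Pts E (AlgebraicClosure (v.adicCompletion K)))
    {z : AlgebraicClosure (v.adicCompletion K)} {d : K}
    (hz : z ^ 2 = algebraMap K (AlgebraicClosure (v.adicCompletion K)) d)
    (hσ : ∀ σ : GalAbs (v.adicCompletion K),
      (σ • R = R ∧ σ z = z) ∨ (σ • R = R + .some _ _ hT ∧ σ z = -z))
    (ha : v.valuation K (coeffA E t) ≤ 1)
    (hab : v.valuation K (coeffA E t ^ 2 - 4 * coeffB E t) = 1) :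
    IsSquare (v.valuation K d) := by
  obtain ⟨e, m, he, hm, h⟩ := exists_squareClass_of_smul_sub_mem hT hs R hz hσ
  rw [← valued_algebraMap_eq] at ha hab ⊢
  have hve : (Valued.v e : WithZero (Multiplicative ℤ)) ≠ 0 := (Valuation.ne_zero_iff _).mpr he
  have hsq : IsSquare (Valued.v e : WithZero (Multiplicative ℤ)) := by
    rcases h with rfl | rfl | ⟨y, hy⟩
    · rw [map_one]; exact IsSquare.one
    · rw [hab]; exact IsSquare.one
    · exact isSquare_valuation_of_sq_eq _ ha hab he hy
  have hv := congrArg (Valued.v (Γ₀ := WithZero (Multiplicative ℤ))) hm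
  rw [map_mul, map_pow] at hv
  rw [eq_div_of_mul_eq hve hv]
  exact (IsSquare.sq _).div hsq

theorem two_dvd_toAdd_valuationOfNeZero (v : HeightOneSpectrum (𝓞 K)) (x : Kˣ)
    (h : IsSquare (v.valuation K (x : K))) :
    (2 : ℤ) ∣ Multiplicative.toAdd (v.valuationOfNeZero x) := by
  rw [← HeightOneSpectrum.valuationOfNeZero_eq] at h
  obtain ⟨r, hr⟩ := h
  have hr0 : r ≠ 0 := by
    rintro rfl
    rw [mul_zero] at hr
    exact WithZero.coe_ne_zero hr
  obtain ⟨r, rfl⟩ := WithZero.ne_zero_iff_exists.mp hr0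
  rw [← WithZero.coe_mul, WithZero.coe_inj] at hr
  exact ⟨Multiplicative.toAdd r, by rw [hr, toAdd_mul, two_mul]⟩

theorem finite_setOf_valuation_ne_one {x : K} (hx : x ≠ 0) :
    {v : HeightOneSpectrum (𝓞 K) | v.valuation K x ≠ 1}.Finite := by
  refine ((HeightOneSpectrum.Support.finite (𝓞 K) x).union
    (HeightOneSpectrum.Support.finite (𝓞 K) x⁻¹)).subset fun v hv => ?_
  rcases lt_or_gt_of_ne hv with h | h
  · right
    change 1 < v.valuation K x⁻¹
    rw [map_inv₀]
    exact (one_lt_inv₀ (zero_lt_iff.mpr ((Valuation.ne_zero_iff _).mpr hx))).mpr h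
  · exact .inl h

end SquareClass

section FiniteSelmer

open IsDedekindDomain

variable {K : Type u} [Field K]

/-- A class in the preimage of the local Kummer image is locally the coboundary of a point. -/
theorem exists_point_of_res_mem_kummerImage {E E' : WeierstrassCurve K} (f : PtsHom E E')
    {F : Type u} [Field F] [Algebra K F] (c : Z1 (GalAbs K) (f.kernel K))
    (h : res F f (QuotientAddGroup.mk c) ∈ kummerImage F f) :
    ∃ R : Pts E (AlgebraicClosure F), ∀ σ : GalAbs F,
      (kernelEmb F f (c.1 (resGal F σ)) : Pts E (AlgebraicClosure F)) = σ • R - R := by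
  obtain ⟨Q, R, c', -, hc', heq⟩ := h
  have hmk : (QuotientAddGroup.mk (Z1.map (resGal (K := K) F) (continuous_resGal F)
      (kernelEmb F f) (kernelEmb_smul F f) c) : H1Ker F f) = QuotientAddGroup.mk c' := heq
  obtain ⟨B, hB⟩ := QuotientAddGroup.eq.mp hmk.symm
  refine ⟨R + B, fun σ => ?_⟩
  have h1 := congrArg Subtype.val (congrFun hB σ)
  have h2 : σ • (B : Pts E (AlgebraicClosure F)) - B =
      -(c'.1 σ : Pts E (AlgebraicClosure F)) + kernelEmb F f (c.1 (resGal F σ)) := h1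
  rw [hc'] at h2
  rw [smul_add, add_sub_add_comm, h2]
  abel

theorem smul_eq_self_of_kernel {E E' : WeierstrassCurve K} {f : PtsHom E E'} {t s : K}
    {hT : (E.baseChange (AlgebraicClosure K)).toAffine.Nonsingular
      (algebraMap K (AlgebraicClosure K) t) (algebraMap K (AlgebraicClosure K) s)}
    (hker : ∀ P ∈ f.kernel K, P = 0 ∨ P = .some _ _ hT) (σ : GalAbs K) (P : f.kernel K) :
    σ • P = P := by
  apply Subtype.ext
  change σ • P.1 = P.1
  rcases hker P.1 P.2 with h | h
  · rw [h, smul_zero]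
  · rw [h]
    exact (WeierstrassCurve.Affine.Point.some.injEq ..).mpr ⟨σ.commutes t, σ.commutes s⟩

/-- A cocycle with values in a rational subgroup of order two is given by a square root. -/
theorem exists_sqrt_of_cocycle [CharZero K] {E E' : WeierstrassCurve K} {f : PtsHom E E'} {t s : K}
    {hT : (E.baseChange (AlgebraicClosure K)).toAffine.Nonsingular
      (algebraMap K (AlgebraicClosure K) t) (algebraMap K (AlgebraicClosure K) s)}
    (h2T : 2 • (.some _ _ hT : Pts E (AlgebraicClosure K)) = 0)
    (hker : ∀ P ∈ f.kernel K, P = 0 ∨ P = .some _ _ hT) (c : Z1 (GalAbs K) (f.kernel K)) :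
    ∃ (d : Kˣ) (z : AlgebraicClosure K), z ^ 2 = algebraMap K _ (d : K) ∧
      ∀ σ : GalAbs K, (c.1 σ = 0 ∧ σ z = z) ∨
        ((c.1 σ : Pts E (AlgebraicClosure K)) = .some _ _ hT ∧ σ z = -z) := by
  have hadd : ∀ σ τ, c.1 (σ * τ) = c.1 σ + c.1 τ := fun σ τ => by
    rw [c.2.2, smul_eq_self_of_kernel hker]
  let χ : GalAbs K →* Multiplicative (f.kernel K) :=
    { toFun := fun σ => Multiplicative.ofAdd (c.1 σ)
      map_one' := by
        have := hadd 1 1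
        rw [mul_one, left_eq_add] at this
        rw [this]; rfl
      map_mul' := fun σ τ => by rw [hadd]; rfl }
  have hmem : ∀ σ, σ ∈ χ.ker ↔ c.1 σ = 0 := fun σ => Iff.rfl
  have hval : ∀ σ, σ ∉ χ.ker → (c.1 σ : Pts E (AlgebraicClosure K)) = .some _ _ hT := by
    intro σ hσ
    refine (hker _ (c.1 σ).2).resolve_left fun h => hσ ((hmem σ).mpr (Subtype.ext h))
  obtain ⟨z, hz0, hz⟩ := exists_sqrt_of_index_two χ.ker (c.2.1.isOpen_fiber 0) (by
    intro σ τ hσ hτ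
    rw [hmem, hadd]
    apply Subtype.ext
    rw [AddSubgroup.coe_add, hval σ hσ, hval τ hτ, ← two_nsmul, h2T]
    rfl)
  obtain ⟨d, hd⟩ := exists_algebraMap_eq_of_fixed (x := z ^ 2) (by
    intro σ
    rcases hz σ with ⟨-, h⟩ | ⟨-, h⟩ <;> rw [map_pow, h]
    ring)
  have hd0 : d ≠ 0 := by
    rintro rfl
    rw [map_zero] at hd
    exact pow_ne_zero 2 hz0 hd.symm
  refine ⟨Units.mk0 d hd0, z, hd.symm, fun σ => ?_⟩
  rcases hz σ with ⟨h1, h2⟩ | ⟨h1, h2⟩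
  · exact .inl ⟨(hmem σ).mp h1, h2⟩
  · exact .inr ⟨hval σ h1, h2⟩

/-- The Selmer group of a homomorphism whose kernel is generated by a rational point of order two
is finite. -/
theorem finite_selmer_of_kernel [NumberField K] {E E' : WeierstrassCurve K} [E.IsElliptic]
    (f : PtsHom E E') {t s : K}
    (hT : (E.baseChange (AlgebraicClosure K)).toAffine.Nonsingular
      (algebraMap K (AlgebraicClosure K) t) (algebraMap K (AlgebraicClosure K) s))
    (h2T : 2 • (.some _ _ hT : Pts E (AlgebraicClosure K)) = 0)
    (hker : ∀ P ∈ f.kernel K, P = 0 ∨ P = .some _ _ hT) : Finite (Selmer f) := by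
  have hs' := (two_nsmul_some_eq_zero_iff two_ne_zero hT).mp h2T
  have hs : centredY E t s = 0 := by
    rwa [centredY_baseChange, FaithfulSMul.algebraMap_eq_zero_iff] at hs'
  have hab : coeffA E t ^ 2 - 4 * coeffB E t ≠ 0 := by
    have := coeffA_sq_sub_ne_zero hT.1 hs' two_ne_zero
    rw [coeffA_baseChange, coeffB_baseChange] at this
    intro h
    apply this
    rw [← map_pow, ← map_ofNat (algebraMap K (AlgebraicClosure K)) 4, ← map_mul, ← map_sub, h,
      map_zero]
  let S : Set (HeightOneSpectrum (𝓞 K)) := HeightOneSpectrum.Support (𝓞 K) (coeffA E t) ∪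
    {v | v.valuation K (coeffA E t ^ 2 - 4 * coeffB E t) ≠ 1}
  have hS : S.Finite :=
    (HeightOneSpectrum.Support.finite (𝓞 K) _).union (finite_setOf_valuation_ne_one hab)
  have hrep : ∀ ξ : Selmer f, ∃ c : Z1 (GalAbs K) (f.kernel K), QuotientAddGroup.mk c = ξ.1 :=
    fun ξ => QuotientAddGroup.mk_surjective ξ.1
  choose c hc using hrep
  choose d z hz hσ using fun ξ : Selmer f => exists_sqrt_of_cocycle h2T hker (c ξ)
  have hmem : ∀ ξ, (QuotientGroup.mk (d ξ) : Kˣ ⧸ (powMonoidHom 2 : Kˣ →* Kˣ).range) ∈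
      selmerGroup (R := 𝓞 K) (K := K) (S := S) (n := 2) := by
    intro ξ v hv
    rw [valuationOfNeZeroMod_mk_eq_one_iff]
    refine two_dvd_toAdd_valuationOfNeZero v _ ?_
    simp only [S, Set.mem_union, not_or, Set.mem_ofPred_eq, not_not] at hv
    have hξ := AddSubgroup.mem_iInf.mp (AddSubgroup.mem_inf.mp ξ.2).1 v
    rw [AddSubgroup.mem_comap, ← hc] at hξ
    obtain ⟨R, hR⟩ := exists_point_of_res_mem_kummerImage f (c ξ) hξ
    have htl : ∀ x : K, closureEmb (K := K) (v.adicCompletion K) (algebraMap K _ x) =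
        algebraMap K (AlgebraicClosure (v.adicCompletion K)) x := AlgHom.commutes _
    have hTv : (E.baseChange (AlgebraicClosure (v.adicCompletion K))).toAffine.Nonsingular
        (algebraMap K (AlgebraicClosure (v.adicCompletion K)) t)
        (algebraMap K (AlgebraicClosure (v.adicCompletion K)) s) := by
      rw [← htl, ← htl]
      exact (E.toAffine.baseChange_nonsingular
        (closureEmb (K := K) (v.adicCompletion K)).injective _ _).mpr hT
    refine isSquare_valuation_of_smul_sub_mem v hTv hs R
      (z := closureEmb (v.adicCompletion K) (z ξ)) ?_ ?_ (not_lt.mp hv.1) hv.2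
    · rw [← map_pow, hz, htl]
    · intro σ
      rw [← closureEmb_resGal]
      rcases hσ ξ (resGal _ σ) with ⟨h1, h2⟩ | ⟨h1, h2⟩
      · refine .inl ⟨?_, by rw [h2]⟩
        rw [← sub_eq_zero, ← hR, h1, map_zero]
        rfl
      · refine .inr ⟨?_, by rw [h2, map_neg]⟩
        rw [← sub_eq_iff_eq_add', ← hR]
        change WeierstrassCurve.Affine.Point.map (W' := E.toAffine)
          (closureEmb (K := K) (v.adicCompletion K)) ((c ξ).1 (resGal _ σ)).1 = _
        rw [h1]
        exact (WeierstrassCurve.Affine.Point.some.injEq ..).mpr ⟨htl t, htl s⟩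
  have : Group.FG (𝓞 K)ˣ := Group.fg_iff_monoid_fg.mpr inferInstance
  have : Finite (selmerGroup (R := 𝓞 K) (K := K) (S := S) (n := 2)) :=
    finite_selmerGroup two_ne_zero hS
  refine Finite.of_injective
    (fun ξ => (⟨_, hmem ξ⟩ : selmerGroup (R := 𝓞 K) (K := K) (S := S) (n := 2))) ?_
  intro ξ η h
  obtain ⟨m, hm⟩ := QuotientGroup.eq.mp (congrArg (fun q => q.1) h)
  have hm' : (d η : K) = (m : K) ^ 2 * d ξ := by
    have : d η = m ^ 2 * d ξ := by
      rw [powMonoidHom_apply] at hm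
      rw [hm, mul_comm, mul_inv_cancel_left]
    rw [this]; push_cast; rfl
  have hzz : z η = algebraMap K _ (m : K) * z ξ ∨ z η = -(algebraMap K _ (m : K) * z ξ) := by
    rw [← sq_eq_sq_iff_eq_or_eq_neg, mul_pow, hz, hz, hm', map_mul, map_pow]
  have hz0 : ∀ ξ, z ξ ≠ 0 := by
    intro ξ h0
    have := hz ξ
    rw [h0, zero_pow two_ne_zero, eq_comm, FaithfulSMul.algebraMap_eq_zero_iff] at this
    exact (d ξ).ne_zero this
  have hneg : ∀ ξ, z ξ ≠ -z ξ := fun ξ h0 => hz0 ξ (self_eq_neg.mp h0)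
  have hiff : ∀ σ : GalAbs K, σ (z ξ) = z ξ ↔ σ (z η) = z η := by
    intro σ
    have hm0 : algebraMap K (AlgebraicClosure K) (m : K) ≠ 0 := by
      rw [ne_eq, FaithfulSMul.algebraMap_eq_zero_iff]; exact m.ne_zero
    rcases hzz with h | h <;> rw [h]
    · rw [map_mul, AlgEquiv.commutes, mul_right_inj' hm0]
    · rw [map_neg, map_mul, AlgEquiv.commutes, neg_inj, mul_right_inj' hm0]
  have hcc : c ξ = c η := by
    apply Subtype.ext
    funext σ
    rcases hσ ξ σ with ⟨h1, h2⟩ | ⟨h1, h2⟩ <;> rcases hσ η σ with ⟨h3, h4⟩ | ⟨h3, h4⟩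
    · rw [h1, h3]
    · exact absurd (((hiff σ).mp h2).symm.trans h4) (hneg η)
    · exact absurd (((hiff σ).mpr h4).symm.trans h2) (hneg ξ)
    · exact Subtype.ext (h1.trans h3.symm)
  apply Subtype.ext
  rw [← hc ξ, ← hc η, hcc]

end FiniteSelmer

section SelmerMap

variable {K : Type u} [Field K]

theorem map_closureEmb_smul {F : Type u} [Field F] [Algebra K F] {E : WeierstrassCurve K}
    (σ : GalAbs F) (P : Pts E (AlgebraicClosure K)) :
    WeierstrassCurve.Affine.Point.map (W' := E.toAffine) (closureEmb (K := K) F)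
        (resGal (K := K) F σ • P) =
      σ • WeierstrassCurve.Affine.Point.map (W' := E.toAffine) (closureEmb (K := K) F) P := by
  rcases P with _ | ⟨x, y, h⟩
  · rfl
  · exact (WeierstrassCurve.Affine.Point.some.injEq ..).mpr
      ⟨closureEmb_resGal F σ x, closureEmb_resGal F σ y⟩

variable {E E' A A' : WeierstrassCurve K}

/-- A cocycle in `ker f` is, over `F`, the coboundary of a geometric point. -/
def IsPointCoboundary (F : Type u) [Field F] [Algebra K F] (f : PtsHom E E')
    (c : Z1 (GalAbs K) (f.kernel K)) : Prop :=
  ∃ R : Pts E (AlgebraicClosure F), ∀ σ : GalAbs F,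
    WeierstrassCurve.Affine.Point.map (W' := E.toAffine) (closureEmb (K := K) F)
      (c.1 (resGal F σ) : Pts E (AlgebraicClosure K)) = σ • R - R

theorem res_mk_mem_kummerImage_iff [CharZero K] (F : Type u) [Field F] [Algebra K F]
    (f : PtsHom E E') (c : Z1 (GalAbs K) (f.kernel K)) :
    res F f (QuotientAddGroup.mk c) ∈ kummerImage F f ↔ IsPointCoboundary F f c := by
  have : CharZero F := charZero_of_injective_algebraMap (algebraMap K F).injective
  refine ⟨exists_point_of_res_mem_kummerImage f c, fun ⟨R, hR⟩ => ?_⟩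
  obtain ⟨Q, hQ⟩ := exists_baseChange_eq_of_fixed (P := f.on (AlgebraicClosure F) R) fun σ => by
    have h := (kernelEmb F f (c.1 (resGal F σ))).2
    rw [AddMonoidHom.mem_ker] at h
    rw [← f.on_smul F, ← sub_eq_zero, ← map_sub, ← hR]
    exact h
  exact ⟨Q, R, _, hQ.symm, hR, rfl⟩

theorem mk_mem_selmer_iff [NumberField K] (f : PtsHom E E') (c : Z1 (GalAbs K) (f.kernel K)) :
    (QuotientAddGroup.mk c : H1Ker K f) ∈ Selmer f ↔
      (∀ v : IsDedekindDomain.HeightOneSpectrum (𝓞 K),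
        IsPointCoboundary (v.adicCompletion K) f c) ∧
      ∀ v : NumberField.InfinitePlace K, IsPointCoboundary v.Completion f c := by
  rw [Selmer, AddSubgroup.mem_inf, AddSubgroup.mem_iInf, AddSubgroup.mem_iInf]
  simp only [AddSubgroup.mem_comap, res_mk_mem_kummerImage_iff]

/-- The map on kernels induced by a homomorphism of curves. -/
noncomputable def kernelMap (f : PtsHom E E') (g : PtsHom A A') (h : PtsHom E A)
    (hfg : ∀ P ∈ f.kernel K, h.on _ P ∈ g.kernel K) : f.kernel K →+ g.kernel K :=
  ((h.on _).comp (f.kernel K).subtype).codRestrict (g.kernel K) fun P => hfg P.1 P.2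

/-- The map on cocycles induced by a homomorphism of curves. -/
noncomputable def cocycleMap (f : PtsHom E E') (g : PtsHom A A') (h : PtsHom E A)
    (hfg : ∀ P ∈ f.kernel K, h.on _ P ∈ g.kernel K) :
    Z1 (GalAbs K) (f.kernel K) →+ Z1 (GalAbs K) (g.kernel K) :=
  Z1.map (MonoidHom.id _) continuous_id (kernelMap f g h hfg)
    fun σ P => Subtype.ext (h.on_smul K σ P.1)

/-- The map on `H¹` induced by a homomorphism of curves. -/
noncomputable def h1Map (f : PtsHom E E') (g : PtsHom A A') (h : PtsHom E A)
    (hfg : ∀ P ∈ f.kernel K, h.on _ P ∈ g.kernel K) : H1Ker K f →+ H1Ker K g :=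
  H1.map (MonoidHom.id _) continuous_id (kernelMap f g h hfg)
    fun σ P => Subtype.ext (h.on_smul K σ P.1)

theorem IsPointCoboundary.map {F : Type u} [Field F] [Algebra K F] {f : PtsHom E E'}
    {c : Z1 (GalAbs K) (f.kernel K)} (hc : IsPointCoboundary F f c) (g : PtsHom A A')
    (h : PtsHom E A) (hfg : ∀ P ∈ f.kernel K, h.on _ P ∈ g.kernel K) :
    IsPointCoboundary F g (cocycleMap f g h hfg c) := by
  obtain ⟨R, hR⟩ := hc
  refine ⟨h.on _ R, fun σ => ?_⟩
  rw [← h.on_smul F, ← map_sub, ← hR, h.natural]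
  rfl

/-- The map on Selmer groups induced by a homomorphism of curves. -/
noncomputable def selmerMap [NumberField K] (f : PtsHom E E') (g : PtsHom A A') (h : PtsHom E A)
    (hfg : ∀ P ∈ f.kernel K, h.on _ P ∈ g.kernel K) : Selmer f →+ Selmer g :=
  ((h1Map f g h hfg).comp (Selmer f).subtype).codRestrict (Selmer g) (by
    rintro ⟨ξ, hξ⟩
    obtain ⟨c, rfl⟩ := QuotientAddGroup.mk_surjective ξ
    rw [mk_mem_selmer_iff] at hξ
    exact (mk_mem_selmer_iff g _).mpr
      ⟨fun v => (hξ.1 v).map g h hfg, fun v => (hξ.2 v).map g h hfg⟩)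

theorem mk_eq_mk_iff {f : PtsHom E E'} (c c' : Z1 (GalAbs K) (f.kernel K)) :
    (QuotientAddGroup.mk c : H1Ker K f) = QuotientAddGroup.mk c' ↔
      ∃ B ∈ f.kernel K, ∀ σ : GalAbs K,
        (c'.1 σ : Pts E (AlgebraicClosure K)) - c.1 σ = σ • B - B := by
  rw [QuotientAddGroup.eq]
  constructor
  · rintro ⟨B, hB⟩
    refine ⟨B.1, B.2, fun σ => ?_⟩
    have h1 : σ • (B : Pts E (AlgebraicClosure K)) - B =
        -(c.1 σ : Pts E (AlgebraicClosure K)) + c'.1 σ := congrArg Subtype.val (congrFun hB σ)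
    rw [h1]
    abel
  · rintro ⟨B, hB, h⟩
    refine ⟨⟨B, hB⟩, funext fun σ => Subtype.ext ?_⟩
    change σ • B - B = -(c.1 σ : Pts E (AlgebraicClosure K)) + c'.1 σ
    rw [← h]
    abel

theorem isLocallyConstant_smul (P : Pts E (AlgebraicClosure K)) :
    IsLocallyConstant fun σ : GalAbs K => σ • P := by
  have hopen : ∃ U : Set (GalAbs K), IsOpen U ∧ 1 ∈ U ∧ ∀ σ ∈ U, σ • P = P := by
    rcases P with _ | ⟨x, y, h⟩
    · exact ⟨Set.univ, isOpen_univ, trivial, fun _ _ => rfl⟩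
    · refine ⟨_, (stabilizer_isOpen_of_isIntegral (K := K) x).inter
        (stabilizer_isOpen_of_isIntegral (K := K) y),
        ⟨one_mem _, one_mem _⟩, fun σ hσ => ?_⟩
      exact (WeierstrassCurve.Affine.Point.some.injEq ..).mpr ⟨hσ.1, hσ.2⟩
  obtain ⟨U, hU, h1, hP⟩ := hopen
  rw [IsLocallyConstant.iff_exists_open]
  intro σ
  refine ⟨(fun τ => σ⁻¹ * τ) ⁻¹' U, hU.preimage (continuous_const_mul σ⁻¹),
    by simpa using h1, fun τ hτ => ?_⟩
  have h2 := congrArg (σ • ·) (hP _ hτ)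
  simp only [← mul_smul, mul_inv_cancel_left] at h2
  exact h2

/-- The cocycle `σ ↦ σ R - R`, for a point `R` such that it takes values in `ker f`. -/
noncomputable def pointCocycle (f : PtsHom E E') (R : Pts E (AlgebraicClosure K))
    (hR : ∀ σ : GalAbs K, σ • R - R ∈ f.kernel K) : Z1 (GalAbs K) (f.kernel K) :=
  ⟨fun σ => ⟨σ • R - R, hR σ⟩, by
    have h : IsLocallyConstant fun σ : GalAbs K => σ • R - R :=
      (isLocallyConstant_smul R).comp (· - R)
    exact (IsLocallyConstant.iff_exists_open _).mpr fun σ => by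
      obtain ⟨U, hU, hσ, h⟩ := (IsLocallyConstant.iff_exists_open _).mp h σ
      exact ⟨U, hU, hσ, fun τ hτ => Subtype.ext (h τ hτ)⟩, fun σ τ => Subtype.ext (by
    change (σ * τ) • R - R = σ • R - R + σ • (τ • R - R)
    rw [mul_smul, smul_sub]
    abel)⟩

theorem mk_pointCocycle_mem_selmer [NumberField K] (f : PtsHom E E')
    (R : Pts E (AlgebraicClosure K)) (hR : ∀ σ : GalAbs K, σ • R - R ∈ f.kernel K) :
    (QuotientAddGroup.mk (pointCocycle f R hR) : H1Ker K f) ∈ Selmer f := by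
  have : ∀ (F : Type u) [Field F] [Algebra K F], IsPointCoboundary F f (pointCocycle f R hR) :=
    fun F _ _ => ⟨WeierstrassCurve.Affine.Point.map (W' := E.toAffine) (closureEmb (K := K) F) R,
      fun σ => by
        change WeierstrassCurve.Affine.Point.map (W' := E.toAffine) (closureEmb (K := K) F)
          (resGal F σ • R - R) = _
        rw [map_sub, map_closureEmb_smul]⟩
  exact (mk_mem_selmer_iff _ _).mpr ⟨fun v => this _, fun v => this _⟩

end SelmerMap

section ExactSequence

variable {K : Type u} [Field K]

/-- The identity homomorphism. -/
noncomputable def PtsHom.id (E : WeierstrassCurve K) : PtsHom E E where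
  on _ _ _ := AddMonoidHom.id _
  natural _ _ _ _ _ _ _ _ := rfl

theorem exists_cocycle_of_mem_kernel {E A A' : WeierstrassCurve K} {f : PtsHom E A}
    {g : PtsHom E A'} (c : Z1 (GalAbs K) (f.kernel K))
    (h : ∀ σ, (c.1 σ : Pts E (AlgebraicClosure K)) ∈ g.kernel K) :
    ∃ c' : Z1 (GalAbs K) (g.kernel K),
      ∀ σ, (c'.1 σ : Pts E (AlgebraicClosure K)) = c.1 σ := by
  refine ⟨⟨fun σ => ⟨_, h σ⟩, (IsLocallyConstant.iff_exists_open _).mpr fun σ => ?_,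
    fun σ τ => Subtype.ext ?_⟩, fun _ => rfl⟩
  · obtain ⟨U, hU, hσ, hc⟩ := (IsLocallyConstant.iff_exists_open _).mp c.2.1 σ
    exact ⟨U, hU, hσ, fun τ hτ => Subtype.ext (congrArg (fun P => P.1) (hc τ hτ))⟩
  · exact congrArg (fun P => P.1) (c.2.2 σ τ)

variable {E E' : WeierstrassCurve K} {φ : Isogeny E E'} {ψ : Isogeny E' E}

theorem mem_kernel_mulTwo_iff (P : Pts E (AlgebraicClosure K)) :
    P ∈ (mulTwo E).kernel K ↔ 2 • P = 0 := Iff.rfl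

theorem mem_kernel_mulTwo_of_mem_kernel (hψ : IsDualTwoIsogeny φ ψ) :
    ∀ P ∈ φ.kernel K, (PtsHom.id E).on _ P ∈ (mulTwo E).kernel K := fun P hP => by
  rw [AddMonoidHom.mem_ker] at hP
  change 2 • P = 0
  rw [← (hψ _).1, hP, map_zero]

theorem mem_kernel_dual_of_mem_kernel_mulTwo (hψ : IsDualTwoIsogeny φ ψ) :
    ∀ P ∈ (mulTwo E).kernel K, φ.on _ P ∈ ψ.kernel K := fun P hP => by
  rw [AddMonoidHom.mem_ker, (hψ _).1]
  exact hP

variable [NumberField K]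

/-- The map `Sel_φ(E) → Sel₂(E)`. -/
noncomputable def selmerToSel₂ (hψ : IsDualTwoIsogeny φ ψ) : Selmer φ.toPtsHom →+ Sel₂ E :=
  selmerMap φ.toPtsHom (mulTwo E) (PtsHom.id E) (mem_kernel_mulTwo_of_mem_kernel hψ)

/-- The map `Sel₂(E) → Sel_ψ(E')`. -/
noncomputable def sel₂ToSelmer (hψ : IsDualTwoIsogeny φ ψ) : Sel₂ E →+ Selmer ψ.toPtsHom :=
  selmerMap (mulTwo E) ψ.toPtsHom φ.toPtsHom (mem_kernel_dual_of_mem_kernel_mulTwo hψ)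

theorem range_selmerToSel₂_le_ker (hψ : IsDualTwoIsogeny φ ψ) :
    (selmerToSel₂ hψ).range ≤ (sel₂ToSelmer hψ).ker := by
  rintro _ ⟨⟨ξ, hξ⟩, rfl⟩
  obtain ⟨c, rfl⟩ := QuotientAddGroup.mk_surjective ξ
  rw [AddMonoidHom.mem_ker]
  apply Subtype.ext
  refine (mk_eq_mk_iff (f := ψ.toPtsHom) _ 0).mpr ⟨0, zero_mem _, fun σ => ?_⟩
  have h := (c.1 σ).2
  rw [AddMonoidHom.mem_ker] at h
  rw [smul_zero, sub_zero, sub_eq_zero]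
  exact h.symm

theorem ker_sel₂ToSelmer_le_range (hψ : IsDualTwoIsogeny φ ψ)
    (hsurj : ∀ Q ∈ ψ.kernel K, ∃ P, φ.on (AlgebraicClosure K) P = Q) :
    (sel₂ToSelmer hψ).ker ≤ (selmerToSel₂ hψ).range := by
  rintro ⟨ξ, hξ⟩ h
  obtain ⟨c, rfl⟩ := QuotientAddGroup.mk_surjective ξ
  rw [AddMonoidHom.mem_ker] at h
  obtain ⟨Q, hQ, hσ⟩ := (mk_eq_mk_iff (f := ψ.toPtsHom) 0 _).mp (congrArg Subtype.val h).symm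
  obtain ⟨P, rfl⟩ := hsurj Q hQ
  have hP : P ∈ (mulTwo E).kernel K := by
    rw [mem_kernel_mulTwo_iff, ← (hψ _).1]
    exact hQ
  have hPσ : ∀ σ : GalAbs K, σ • P - P ∈ (mulTwo E).kernel K := fun σ =>
    sub_mem (σ • (⟨P, hP⟩ : (mulTwo E).kernel K)).2 hP
  have hval : ∀ σ : GalAbs K, (c.1 σ : Pts E (AlgebraicClosure K)) - (σ • P - P) ∈ φ.kernel K := by
    intro σ
    have h1 : φ.on _ (c.1 σ : Pts E (AlgebraicClosure K)) - 0 = σ • φ.on _ P - φ.on _ P := hσ σ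
    rw [AddMonoidHom.mem_ker, map_sub, map_sub, φ.on_smul K, ← h1, sub_zero, sub_self]
  obtain ⟨c₂, hc₂⟩ : ∃ c₂, c₂ = c - pointCocycle (mulTwo E) P hPσ := ⟨_, rfl⟩
  have hc₂σ : ∀ σ, (c₂.1 σ : Pts E (AlgebraicClosure K)) = c.1 σ - (σ • P - P) := fun σ => by
    rw [hc₂]; rfl
  obtain ⟨c₁, hc₁⟩ := exists_cocycle_of_mem_kernel (g := φ.toPtsHom) c₂ fun σ => by
    rw [hc₂σ]; exact hval σ
  have hmem₂ : (QuotientAddGroup.mk c₂ : H1Ker K (mulTwo E)) ∈ Selmer (mulTwo E) := by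
    rw [hc₂]
    exact sub_mem hξ (mk_pointCocycle_mem_selmer _ _ _)
  have hloc : ∀ (F : Type u) [Field F] [Algebra K F], IsPointCoboundary F (mulTwo E) c₂ →
      IsPointCoboundary F φ.toPtsHom c₁ := fun F _ _ ⟨R, hR⟩ =>
    ⟨R, fun σ => by rw [hc₁, hR]⟩
  rw [mk_mem_selmer_iff] at hmem₂
  have hmem₁ : (QuotientAddGroup.mk c₁ : H1Ker K φ.toPtsHom) ∈ Selmer φ.toPtsHom :=
    (mk_mem_selmer_iff _ _).mpr ⟨fun v => hloc _ (hmem₂.1 v), fun v => hloc _ (hmem₂.2 v)⟩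
  refine ⟨⟨_, hmem₁⟩, Subtype.ext ?_⟩
  refine (mk_eq_mk_iff (f := mulTwo E) (cocycleMap _ _ (PtsHom.id E)
    (mem_kernel_mulTwo_of_mem_kernel hψ) c₁) c).mpr ⟨P, hP, fun σ => ?_⟩
  have h3 : (c₁.1 σ : Pts E (AlgebraicClosure K)) = c.1 σ - (σ • P - P) := by rw [hc₁, hc₂σ]
  change (c.1 σ : Pts E (AlgebraicClosure K)) - (c₁.1 σ : Pts E (AlgebraicClosure K)) = _
  rw [h3, sub_sub_cancel]

theorem card_ker_selmerToSel₂_le (hψ : IsDualTwoIsogeny φ ψ) [Finite (ψ.kernel K)] :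
    Nat.card (selmerToSel₂ hψ).ker ≤ Nat.card (ψ.kernel K) := by
  have hex : ∀ ξ : (selmerToSel₂ hψ).ker, ∃ (c : Z1 (GalAbs K) (φ.kernel K))
      (B : Pts E (AlgebraicClosure K)), QuotientAddGroup.mk c = ξ.1.1 ∧
      B ∈ (mulTwo E).kernel K ∧
      ∀ σ : GalAbs K, (c.1 σ : Pts E (AlgebraicClosure K)) = σ • B - B := by
    rintro ⟨⟨ξ, hξ⟩, h⟩
    obtain ⟨c, rfl⟩ := QuotientAddGroup.mk_surjective ξ
    rw [AddMonoidHom.mem_ker] at h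
    obtain ⟨B, hB, hσ⟩ := (mk_eq_mk_iff (f := mulTwo E) 0 _).mp (congrArg Subtype.val h).symm
    refine ⟨c, B, rfl, hB, fun σ => ?_⟩
    have h1 : (c.1 σ : Pts E (AlgebraicClosure K)) - 0 = σ • B - B := hσ σ
    rwa [sub_zero] at h1
  choose c B hc hB hσ using hex
  refine Nat.card_le_card_of_injective (fun ξ => (⟨φ.on _ (B ξ),
    mem_kernel_dual_of_mem_kernel_mulTwo hψ _ (hB ξ)⟩ : ψ.kernel K)) fun ξ η h => ?_
  apply Subtype.ext
  apply Subtype.ext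
  rw [← hc, ← hc]
  refine (mk_eq_mk_iff (f := φ.toPtsHom) _ _).mpr ⟨B η - B ξ, ?_, fun σ => ?_⟩
  · rw [AddMonoidHom.mem_ker, map_sub, sub_eq_zero]
    exact (congrArg Subtype.val h).symm
  · rw [hσ, hσ, smul_sub]
    abel

end ExactSequence

section Cardinality

theorem card_eq_two_pow_dimF₂ (A : Type*) [AddCommGroup A] [Finite A] (h : ∀ a : A, 2 • a = 0) :
    Nat.card A = 2 ^ dimF₂ A h := by
  let _ : Module (ZMod 2) A := AddCommGroup.zmodModule h
  have := Module.natCard_eq_pow_finrank (K := ZMod 2) (V := A)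
  rw [Nat.card_zmod] at this
  exact this

theorem two_nsmul_selmer {K : Type u} [Field K] [NumberField K] {E E' : WeierstrassCurve K}
    {f : PtsHom E E'} (hf : ∀ P ∈ f.kernel K, 2 • P = 0) (ξ : Selmer f) : 2 • ξ = 0 := by
  obtain ⟨ξ, hξ⟩ := ξ
  apply Subtype.ext
  obtain ⟨c, rfl⟩ := QuotientAddGroup.mk_surjective ξ
  have hc : 2 • c = 0 :=
    Subtype.ext (funext fun σ => Subtype.ext (hf _ (c.1 σ).2))
  change 2 • (QuotientAddGroup.mk' (B1 _ _) c) = 0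
  rw [← map_nsmul, hc, map_zero]

/-- If `A → B → C` is a complex of finite groups with kernel of `A → B` of order at most two and
`B → C` nonzero, then `A` has at most as many elements as `B`. -/
theorem card_le_card_of_complex {A B C : Type*} [AddCommGroup A] [AddCommGroup B] [AddCommGroup C]
    [Finite A] [Finite B] (α : A →+ B) (β : B →+ C) (hker : Nat.card α.ker ≤ 2)
    (hαβ : α.range ≤ β.ker) {b : B} (hb : β b ≠ 0) : Nat.card A ≤ Nat.card B := by
  have h1 : Nat.card A = Nat.card α.range * Nat.card α.ker := by
    rw [AddSubgroup.card_eq_card_quotient_mul_card_addSubgroup α.ker,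
      Nat.card_congr (QuotientAddGroup.quotientKerEquivRange α).toEquiv]
  have h2 : Nat.card β.ker * 2 ≤ Nat.card B := by
    rw [← β.ker.card_mul_index]
    refine Nat.mul_le_mul_left _ ?_
    have h3 : β.ker.index ≠ 0 := AddSubgroup.index_ne_zero_of_finite
    have h4 : β.ker.index ≠ 1 := by
      rw [ne_eq, AddSubgroup.index_eq_one]
      intro htop
      exact hb (AddMonoidHom.mem_ker.mp (htop ▸ AddSubgroup.mem_top b))
    omega
  rw [h1]
  refine le_trans (Nat.mul_le_mul ?_ hker) h2
  exact Nat.card_le_card_of_injective (AddSubgroup.inclusion hαβ)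
    (AddSubgroup.inclusion_injective hαβ)

end Cardinality

section DualKernel

variable {K : Type u} [Field K] {E E' : WeierstrassCurve K} {φ : Isogeny E E'} {ψ : Isogeny E' E}

theorem mem_twoTorsion_iff {L : Type u} [Field L] [Algebra K L] (P : Pts E L) :
    P ∈ twoTorsion E L ↔ 2 • P = 0 := by
  rw [← ofNat_zsmul]
  rfl

theorem exists_generator_twoTorsion (hE : Nonempty (twoTorsion E K ≃+ ZMod 2)) :
    ∃ T : Pts E K, 2 • T = 0 ∧ T ≠ 0 ∧ ∀ P : Pts E K, 2 • P = 0 → P = 0 ∨ P = T := by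
  obtain ⟨e⟩ := hE
  refine ⟨(e.symm 1).1, (mem_twoTorsion_iff _).mp (e.symm 1).2, fun h => ?_, fun P hP => ?_⟩
  · have h1 : e.symm 1 = 0 := Subtype.ext h
    rw [EmbeddingLike.map_eq_zero_iff] at h1
    exact one_ne_zero h1
  · have h01 : ∀ a : ZMod 2, a = 0 ∨ a = 1 := by decide
    let P' : twoTorsion E K := ⟨P, (mem_twoTorsion_iff P).mpr hP⟩
    rcases h01 (e P') with h | h
    · rw [EmbeddingLike.map_eq_zero_iff] at h
      exact .inl (congrArg Subtype.val h)
    · right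
      rw [← h, AddEquiv.symm_apply_apply]

theorem mem_rationalTwoTorsion_iff {T : Pts E K} (hT : 2 • T = 0)
    (hall : ∀ P : Pts E K, 2 • P = 0 → P = 0 ∨ P = T) (P : Pts E (AlgebraicClosure K)) :
    P ∈ rationalTwoTorsion E ↔
      P = 0 ∨ P = WeierstrassCurve.Affine.Point.baseChange K (AlgebraicClosure K) T := by
  constructor
  · rintro ⟨Q, hQ, rfl⟩
    rcases hall Q ((mem_twoTorsion_iff Q).mp hQ) with rfl | rfl
    · exact .inl (map_zero _)
    · exact .inr rfl
  · rintro (rfl | rfl)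
    · exact zero_mem _
    · exact ⟨T, (mem_twoTorsion_iff T).mpr hT, rfl⟩

theorem smul_eq_self_of_mem_kernel {A A' : WeierstrassCurve K} (f : PtsHom A A')
    {T : Pts A (AlgebraicClosure K)} (hT0 : T ≠ 0) (hker : ∀ Q, Q ∈ f.kernel K ↔ Q = 0 ∨ Q = T)
    (σ : GalAbs K) : σ • T = T := by
  have h : σ • T ∈ f.kernel K := (σ • (⟨T, (hker T).mpr (.inr rfl)⟩ : f.kernel K)).2
  exact ((hker _).mp h).resolve_left fun h0 => hT0 ((smul_eq_zero_iff_eq σ).mp h0)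

theorem card_kernel_le_two (f : PtsHom E E') {T : Pts E (AlgebraicClosure K)}
    (hker : ∀ P, P ∈ f.kernel K ↔ P = 0 ∨ P = T) :
    Finite (f.kernel K) ∧ Nat.card (f.kernel K) ≤ 2 := by
  have hset : ((f.kernel K : AddSubgroup _) : Set (Pts E (AlgebraicClosure K))) = {0, T} := by
    ext P
    exact hker P
  constructor
  · exact Set.Finite.to_subtype (by rw [hset]; exact Set.toFinite _)
  · change Nat.card ((f.kernel K : AddSubgroup _) : Set (Pts E (AlgebraicClosure K))) ≤ 2
    rw [hset, Nat.card_coe_set_eq]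
    exact (Set.ncard_insert_le _ _).trans (by rw [Set.ncard_singleton])

variable [CharZero K]

/-- If all two-torsion points are fixed by the Galois group, the two-division field is trivial. -/
theorem twoDivisionField_eq_bot
    (h : ∀ P : Pts E (AlgebraicClosure K), 2 • P = 0 → ∀ σ : GalAbs K, σ • P = P) :
    twoDivisionField E = ⊥ := by
  rw [twoDivisionField, IntermediateField.adjoin_eq_bot_iff]
  rintro z ⟨x, y, hxy, h2, hz⟩
  have hfix : ∀ σ : GalAbs K, σ x = x ∧ σ y = y := fun σ =>
    (WeierstrassCurve.Affine.Point.some.injEq ..).mp (h _ ((mem_twoTorsion_iff _).mp h2) σ)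
  refine (InfiniteGalois.mem_bot_iff_fixed z).mpr fun σ => ?_
  rcases hz with rfl | rfl
  exacts [(hfix σ).1, (hfix σ).2]

theorem smul_eq_self_of_twoDivisionField_eq_bot (h : twoDivisionField E = ⊥)
    {P : Pts E (AlgebraicClosure K)} (hP : 2 • P = 0) (σ : GalAbs K) : σ • P = P := by
  rw [twoDivisionField, IntermediateField.adjoin_eq_bot_iff] at h
  rcases P with _ | ⟨x, y, hxy⟩
  · rfl
  · have hmem := (mem_twoTorsion_iff _).mpr hP
    exact (WeierstrassCurve.Affine.Point.some.injEq ..).mpr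
      ⟨(InfiniteGalois.mem_bot_iff_fixed x).mp (h ⟨x, y, hxy, hmem, .inl rfl⟩) σ,
        (InfiniteGalois.mem_bot_iff_fixed y).mp (h ⟨x, y, hxy, hmem, .inr rfl⟩) σ⟩

/-- The kernel of the dual isogeny is generated by the image of a two-torsion point. -/
theorem exists_generator_kernel_dual [E.IsElliptic] (hψ : IsDualTwoIsogeny φ ψ)
    {T : Pts E (AlgebraicClosure K)} (hT : 2 • T = 0) (hT0 : T ≠ 0)
    (hker : ∀ P, P ∈ φ.kernel K ↔ P = 0 ∨ P = T) :
    ∃ S : Pts E (AlgebraicClosure K), 2 • S = 0 ∧ S ≠ 0 ∧ S ≠ T ∧ φ.on _ S ≠ 0 ∧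
      ∀ Q, Q ∈ ψ.kernel K ↔ Q = 0 ∨ Q = φ.on _ S := by
  obtain ⟨S, hS, hS0, hST⟩ := exists_twoTorsion_ne two_ne_zero hT hT0
  obtain ⟨R, hR⟩ := exists_two_nsmul_eq two_ne_zero hT hT0
  have hφT : φ.on _ T = 0 := (hker T).mpr (.inr rfl)
  have hφS0 : φ.on _ S ≠ 0 := fun h => (not_or.mpr ⟨hS0, hST⟩) ((hker S).mp h)
  have hψφS : ψ.on _ (φ.on _ S) = 0 := by rw [(hψ _).1, hS]
  have hψφR : ψ.on _ (φ.on _ R) = T := by rw [(hψ _).1, hR]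
  refine ⟨S, hS, hS0, hST, hφS0, fun Q => ⟨fun hQ => ?_, ?_⟩⟩
  · rw [AddMonoidHom.mem_ker] at hQ
    have h2Q : 2 • Q = 0 := by rw [← (hψ _).2, hQ, map_zero]
    rcases twoTorsion_eq_or two_ne_zero (T := φ.on _ S) (Q := φ.on _ R)
      (by rw [← map_nsmul, hS, map_zero]) hφS0 (by rw [← map_nsmul, hR, hφT])
      (fun h => hT0 (by rw [← hψφR, h, map_zero]))
      (fun h => hT0 (by rw [← hψφR, h, hψφS])) h2Q with h | h | h | h
    · exact .inl h
    · exact .inr h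
    · rw [h, hψφR] at hQ
      exact absurd hQ hT0
    · rw [h, map_add, hψφR, hψφS, add_zero] at hQ
      exact absurd hQ hT0
  · rintro (rfl | rfl)
    · exact zero_mem _
    · exact hψφS

end DualKernel

section Main

variable {K : Type u} [Field K] [NumberField K] {E E' : WeierstrassCurve K}

theorem finite_selmer_of_generator [E.IsElliptic] (f : PtsHom E E')
    {T : Pts E (AlgebraicClosure K)} (hT : 2 • T = 0) (hT0 : T ≠ 0)
    (hker : ∀ P, P ∈ f.kernel K ↔ P = 0 ∨ P = T) : Finite (Selmer f) := by
  obtain ⟨T₀, rfl⟩ := exists_baseChange_eq_of_fixed (smul_eq_self_of_mem_kernel f hT0 hker)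
  rcases T₀ with _ | ⟨t, s, h⟩
  · exact absurd (map_zero _) hT0
  · exact finite_selmer_of_kernel f _ hT fun P hP => (hker P).mp hP

/-- The class of a rational two-torsion point in `Sel₂` has nonzero image in the Selmer group of the
dual isogeny, when the two-division fields agree. -/
theorem exists_sel₂ToSelmer_ne_zero [E.IsElliptic] [E'.IsElliptic] {φ : Isogeny E E'}
    {ψ : Isogeny E' E} (hψ : IsDualTwoIsogeny φ ψ)
    (hfield : twoDivisionField E = twoDivisionField E') {T : Pts E K} (hT : 2 • T = 0)
    (hT0 : T ≠ 0) (hall : ∀ P : Pts E K, 2 • P = 0 → P = 0 ∨ P = T)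
    (hker : ∀ P, P ∈ φ.kernel K ↔
      P = 0 ∨ P = WeierstrassCurve.Affine.Point.baseChange K (AlgebraicClosure K) T) :
    ∃ ξ, sel₂ToSelmer hψ ξ ≠ 0 := by
  set ι := WeierstrassCurve.Affine.Point.baseChange (W' := E.toAffine) K (AlgebraicClosure K)
    with hι
  have hιinj : Function.Injective ι := WeierstrassCurve.Affine.Point.map_injective _
  have hT' : 2 • ι T = 0 := by rw [← map_nsmul, hT, map_zero]
  have hT0' : ι T ≠ 0 := fun h => hT0 (hιinj (h.trans (map_zero ι).symm))
  obtain ⟨S, hS, hS0, hST, hφS0, hkerψ⟩ := exists_generator_kernel_dual hψ hT' hT0' hker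
  obtain ⟨R, hR⟩ := exists_two_nsmul_eq two_ne_zero hT' hT0'
  have hRσ : ∀ σ : GalAbs K, σ • R - R ∈ (mulTwo E).kernel K := fun σ => by
    have h2 : 2 • (σ • R) = σ • (2 • R) := (map_nsmul (DistribSMul.toAddMonoidHom _ σ) 2 R).symm
    rw [mem_kernel_mulTwo_iff, nsmul_sub, h2, hR, smul_baseChange, sub_self]
  refine ⟨⟨_, mk_pointCocycle_mem_selmer (mulTwo E) R hRσ⟩, fun h => ?_⟩
  obtain ⟨B, hB, hσ⟩ := (mk_eq_mk_iff (f := ψ.toPtsHom) 0 _).mp (congrArg Subtype.val h).symm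
  have hσ' : ∀ σ : GalAbs K, φ.on _ (σ • R - R) = σ • B - B := fun σ => by
    have : φ.on _ (σ • R - R) - 0 = σ • B - B := hσ σ
    rwa [sub_zero] at this
  have hQ : ∀ σ : GalAbs K, σ • (φ.on _ R - B) = φ.on _ R - B := fun σ => by
    have := hσ' σ
    rw [map_sub, φ.on_smul K] at this
    rw [smul_sub, ← sub_eq_zero, sub_sub_sub_comm, this, sub_self]
  have hψQ : ψ.on _ (φ.on _ R - B) = ι T := by
    rw [AddMonoidHom.mem_ker] at hB
    rw [map_sub, hB, sub_zero, (hψ _).1, hR]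
  have h2Q : 2 • (φ.on _ R - B) = 0 := by
    rw [← (hψ _).2, hψQ]
    exact (hker _).mpr (.inr rfl)
  have hψS : ψ.on _ (φ.on _ S) = 0 := by rw [(hψ _).1, hS]
  have hbot : twoDivisionField E' = ⊥ := by
    refine twoDivisionField_eq_bot fun P hP σ => ?_
    have hSσ := smul_eq_self_of_mem_kernel ψ.toPtsHom hφS0 hkerψ σ
    rcases twoTorsion_eq_or two_ne_zero (T := φ.on _ S)
      (by rw [← map_nsmul, hS, map_zero]) hφS0 h2Q
      (fun h0 => hT0' (by rw [← hψQ, h0, map_zero]))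
      (fun h0 => hT0' (by rw [← hψQ, h0, hψS])) hP with h | h | h | h
    · rw [h, smul_zero]
    · rw [h, hSσ]
    · rw [h, hQ]
    · rw [h, smul_add, hQ, hSσ]
  obtain ⟨S₀, hS₀⟩ := exists_baseChange_eq_of_fixed
    (smul_eq_self_of_twoDivisionField_eq_bot (hfield.trans hbot) hS)
  have hS₀' : ι S₀ = S := hS₀
  rcases hall S₀ (hιinj (by rw [map_nsmul, hS₀', hS, map_zero])) with h0 | h0
  · exact hS0 (by rw [← hS₀', h0, map_zero])
  · exact hST (by rw [← hS₀', h0])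

end Main

end TwoDescent

theorem proposition4p1 {K : Type u} [Field K] [NumberField K]
    (E E' : WeierstrassCurve K) [E.IsElliptic] [E'.IsElliptic]
    (hE : Nonempty (TwoDescent.twoTorsion E K ≃+ ZMod 2))
    (φ : TwoDescent.Isogeny E E')
    (hφ : φ.kernel K = TwoDescent.rationalTwoTorsion E)
    (ψ : TwoDescent.Isogeny E' E)
    (hψ : TwoDescent.IsDualTwoIsogeny φ ψ)
    (hfield : TwoDescent.twoDivisionField E = TwoDescent.twoDivisionField E') :
    Finite (TwoDescent.Sel₂ E) ∧
    Finite (TwoDescent.Selmer φ.toPtsHom) ∧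
    Finite (TwoDescent.Selmer ψ.toPtsHom) ∧
    padicValRat 2 (TwoDescent.tamagawaRatio φ ψ) ≤ TwoDescent.d₂ E := by
  open TwoDescent in
  obtain ⟨T, hT, hT0, hall⟩ := exists_generator_twoTorsion hE
  have hker := fun P => (hφ ▸ mem_rationalTwoTorsion_iff hT hall P :
    P ∈ φ.kernel K ↔
      P = 0 ∨ P = WeierstrassCurve.Affine.Point.baseChange K (AlgebraicClosure K) T)
  have hT' : 2 • WeierstrassCurve.Affine.Point.baseChange (W' := E.toAffine) K
      (AlgebraicClosure K) T = 0 := by rw [← map_nsmul, hT, map_zero]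
  have hT0' : WeierstrassCurve.Affine.Point.baseChange (W' := E.toAffine) K
      (AlgebraicClosure K) T ≠ 0 := fun h =>
    hT0 (WeierstrassCurve.Affine.Point.map_injective _ (h.trans (map_zero _).symm))
  obtain ⟨S, hS, -, -, hφS0, hkerψ⟩ := exists_generator_kernel_dual hψ hT' hT0' hker
  have h2S : 2 • φ.on (AlgebraicClosure K) S = 0 := by rw [← map_nsmul, hS, map_zero]
  have hfinφ : Finite (Selmer φ.toPtsHom) := finite_selmer_of_generator _ hT' hT0' hker
  have hfinψ : Finite (Selmer ψ.toPtsHom) := finite_selmer_of_generator _ h2S hφS0 hkerψ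
  have hfinker : Finite (sel₂ToSelmer hψ).ker := by
    have hle := ker_sel₂ToSelmer_le_range hψ fun Q hQ => by
      rcases (hkerψ Q).mp hQ with rfl | rfl
      exacts [⟨0, map_zero _⟩, ⟨S, rfl⟩]
    have : Finite (selmerToSel₂ hψ).range := Set.finite_range (selmerToSel₂ hψ)
    exact Finite.of_injective _ (AddSubgroup.inclusion_injective hle)
  have hfin₂ : Finite (Sel₂ E) :=
    finite_of_map_eq_imp_neg_add_mem (sel₂ToSelmer hψ).ker (sel₂ToSelmer hψ) fun a b h => by
      rw [AddMonoidHom.mem_ker, map_add, map_neg, h, neg_add_cancel]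
  refine ⟨hfin₂, hfinφ, hfinψ, ?_⟩
  obtain ⟨ξ, hξ⟩ := exists_sel₂ToSelmer_ne_zero hψ hfield hT hT0 hall hker
  obtain ⟨hfinkerψ, hcardψ⟩ := card_kernel_le_two ψ.toPtsHom hkerψ
  have hle : Nat.card (Selmer φ.toPtsHom) ≤ Nat.card (Sel₂ E) :=
    card_le_card_of_complex (selmerToSel₂ hψ) (sel₂ToSelmer hψ)
      ((card_ker_selmerToSel₂_le hψ).trans hcardψ) (range_selmerToSel₂_le_ker hψ) hξ
  have hφ2 : ∀ ξ : Selmer φ.toPtsHom, 2 • ξ = 0 :=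
    two_nsmul_selmer fun P hP => mem_kernel_mulTwo_of_mem_kernel hψ P hP
  have hψ2 : ∀ ξ : Selmer ψ.toPtsHom, 2 • ξ = 0 := two_nsmul_selmer fun Q hQ => by
    rw [← (hψ _).2, AddMonoidHom.mem_ker.mp hQ, map_zero]
  have hfinE : Finite (twoTorsion E K) := Finite.of_equiv _ hE.some.symm.toEquiv
  have hcφ := card_eq_two_pow_dimF₂ _ hφ2
  have hcψ := card_eq_two_pow_dimF₂ _ hψ2
  have hc₂ := card_eq_two_pow_dimF₂ _ (two_nsmul_sel₂ E)
  have hcE := card_eq_two_pow_dimF₂ (twoTorsion E K) (AddSubgroup.torsionBy.nsmul (n := 2))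
  have hdE : dimF₂ (twoTorsion E K) (AddSubgroup.torsionBy.nsmul (n := 2)) = 1 := by
    rw [Nat.card_congr hE.some.toEquiv, Nat.card_zmod] at hcE
    exact (Nat.pow_right_injective le_rfl (by simpa using hcE)).symm
  have hdle : dimF₂ _ hφ2 ≤ dimF₂ _ (two_nsmul_sel₂ E) := by
    rw [hcφ, hc₂] at hle
    exact (Nat.pow_le_pow_iff_right one_lt_two).mp hle
  have hdψ : 1 ≤ dimF₂ _ hψ2 := by
    by_contra! h0
    rw [Nat.lt_one_iff.mp h0, pow_zero] at hcψ
    have := (Nat.card_eq_one_iff_unique.mp hcψ).1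
    exact hξ (Subsingleton.elim _ _)
  rw [tamagawaRatio, hcφ, hcψ, d₂, hdE]
  push_cast
  have hself : padicValRat 2 (2 : ℚ) = 1 := by exact_mod_cast padicValRat.self one_lt_two
  rw [padicValRat.div (by positivity) (by positivity), padicValRat.pow, padicValRat.pow, hself]
  omega
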